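/- Let $-\infty\le\alpha<\beta\le\infty$ and let $f$ be an analytic almost periodic function in the vertical strip $U=\{s\in\mathbb{C}:\alpha<\operatorname{Re}s<\beta\}$, that is, $f$ is analytic in $U$ and for every reduced strip $a\le\operatorname{Re}s\le b$ with $\alpha<a\le b<\beta$ and every $\varepsilon>0$ there is $l>0$ such that every open interval of length $l$ contains a number $\tau$ with $|f(s+i\tau)-f(s)|\le\varepsilon$ for all $s$ in the reduced strip. Let $\sum_{n\ge1}a_ne^{\lambda_ns}$ be the Dirichlet series of $f$: its (Fourier) exponents $\lambda_n$ are the real numbers $\lambda$ for which the coefficient $$\lim_{T\to\infty}\frac1{2T}\int_{-T}^{T}f(\sigma+it)\,e^{-\lambda(\sigma+it)}\,dt$$ (which does not depend on $\sigma\in(\alpha,\beta)$) is not $0$, and $a_n$ is the coefficient at $\lambda=\lambda_n$. Suppose that there are at least three exponents (finitely or infinitely many) and that they are linearly independent over $\mathbb{Q}$. Put $$R_f=\overline{\{\operatorname{Re}s: s\in U,\ f(s)=0\}}\cap(\alpha,\beta),$$ and call an open interval $(c,d)$, $c<d$, a gap of $R_f$ if $c,d\in R_f$ and $(c,d)\cap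 R_f=\emptyset$. For each $k$ consider the equation $$|a_k|e^{\lambda_k\sigma}=\sum_{i\ne k}|a_i|e^{\lambda_i\sigma},\qquad \sigma\in(\alpha,\beta).\tag{$E_k$}$$ Then: 1. Every boundary point $\sigma_0\in(\alpha,\beta)$ of $R_f$ is a solution of $(E_k)$ for exactly one $k$. 2. If moreover $\sigma_0$ is neither the least nor the greatest element of $R_f$, then that equation $(E_k)$ has exactly two solutions in $(\alpha,\beta)$. 3. The gaps of $R_f$ are produced by those equations $(E_k)$ that have two solutions in $(\alpha,\beta)$: an open interval $(c,d)$ with $c<d$ is a gap of $R_f$ if and only if, for some $k$, the set of solutions of $(E_k)$ in $(\alpha,\beta)$ is $\{c,d\}$. -/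

import Mathlib

open Set Filter Topology

noncomputable section

namespace APStrip

/-- The open vertical strip `{s : α < Re s < β}`; the bounds may be infinite. -/
def strip (α β : EReal) : Set ℂ :=
  {s | α < (s.re : EReal) ∧ (s.re : EReal) < β}

/-- Analytic almost periodic functions in the open vertical strip `α < Re s < β`:
`f` is analytic there and, on every reduced strip `a ≤ Re s ≤ b` (`α < a ≤ b < β`), for each
`ε > 0` there is a length `l` such that every open interval of length `l` contains a number `τ`
with `|f (s + iτ) - f s| ≤ ε` throughout the reduced strip. -/
structure IsAlmostPeriodic (α β : EReal) (f : ℂ → ℂ) : Prop where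
  analytic : DifferentiableOn ℂ f (strip α β)
  translation : ∀ a b : ℝ, α < (a : EReal) → a ≤ b → (b : EReal) < β → ∀ ε : ℝ, 0 < ε →
    ∃ l : ℝ, 0 < l ∧ ∀ t₀ : ℝ, ∃ τ ∈ Ioo t₀ (t₀ + l), ∀ s : ℂ, a ≤ s.re → s.re ≤ b →
      ‖f (s + Complex.I * τ) - f s‖ ≤ ε

/-- `c` is the coefficient of `e^{μ s}` in the Dirichlet (Fourier) series of `f` in the strip:
on each vertical line of the strip, `c` is the mean value of `f s * e^{-μ s}`. -/
def IsFourierCoeff (α β : EReal) (f : ℂ → ℂ) (μ : ℝ) (c : ℂ) : Prop :=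
  ∀ σ : ℝ, α < (σ : EReal) → (σ : EReal) < β →
    Tendsto
      (fun T : ℝ => (1 / (2 * T) : ℂ) *
        ∫ t in (-T)..T, f (σ + Complex.I * t) * Complex.exp (-(μ * (σ + Complex.I * t))))
      atTop (𝓝 c)

open Classical in
/-- The coefficient `a_μ` of `e^{μ s}` in the Dirichlet series of `f`
(the value `0` is used when the mean value does not exist). -/
def fourierCoeff (α β : EReal) (f : ℂ → ℂ) (μ : ℝ) : ℂ :=
  if h : ∃ c, IsFourierCoeff α β f μ c then h.choose else 0

/-- The Fourier exponents of `f`: the `μ` whose coefficient is nonzero. -/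
def fourierExponents (α β : EReal) (f : ℂ → ℂ) : Set ℝ :=
  {μ | fourierCoeff α β f μ ≠ 0}

/-- `R_f`: the points of `(α, β)` in the closure of the set of real parts of the zeros of `f`
in the strip. -/
def realProj (α β : EReal) (f : ℂ → ℂ) : Set ℝ :=
  closure (Complex.re '' {s | s ∈ strip α β ∧ f s = 0}) ∩
    {σ : ℝ | α < (σ : EReal) ∧ (σ : EReal) < β}

/-- The solutions `σ ∈ (α, β)` of `|a_k| e^{k σ} = ∑_{i ≠ k} |a_i| e^{i σ}`, where `k` is a
Fourier exponent and `i` runs over the other Fourier exponents. -/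
def solutions (α β : EReal) (f : ℂ → ℂ) (k : fourierExponents α β f) : Set ℝ :=
  {σ : ℝ | α < (σ : EReal) ∧ (σ : EReal) < β ∧
    HasSum
      (fun i : {i : fourierExponents α β f // i ≠ k} =>
        ‖fourierCoeff α β f (i.1 : ℝ)‖ * Real.exp ((i.1 : ℝ) * σ))
      (‖fourierCoeff α β f (k : ℝ)‖ * Real.exp ((k : ℝ) * σ))}

/-- `(c, d)` is a gap of `R`: a nonempty open interval that misses `R` and whose two endpoints
belong to `R`. -/
def IsGap (R : Set ℝ) (c d : ℝ) : Prop :=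
  c < d ∧ c ∈ R ∧ d ∈ R ∧ Disjoint (Ioo c d) R

end APStrip

end

/-! Write `A_k(σ) = |a_k| e^{λ_k σ}`. The heart of the matter is that `R_f` consists of the `σ` in
`(α, β)` at which no `A_k(σ)` exceeds the sum of the others (`mem_realProj_iff`).

Independence of the exponents first makes the Dirichlet series converge absolutely: testing `f` on a
vertical line against a Riesz product bounds `∑ A_k(σ)` by twice the supremum of `|f|` on the line
(`sum_norm_le_of_independent`). The series then sums to `f`, because an almost periodic function
whose coefficients all vanish is zero (`eq_zero_of_hasMean_zero`).

At a zero of `f` the polygon inequalities are just the triangle inequality, and by continuity they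
survive in the closure. Conversely, if they hold at `σ`, the lengths `A_k(σ)` close up to a polygon
(`exists_polygon`), so after a change of phases of the coefficients the series vanishes at `σ`. By
Kronecker's theorem vertical translates of `f` approximate the series with changed phases uniformly
on a closed strip around `σ`, and Hurwitz's theorem gives zeros of `f` with real part near `σ`.

What remains is convexity. After division by `e^{λ_k σ}` the defect `∑_{i≠k} A_i - A_k` is a
constant plus positive multiples of exponentials with nonzero rates, hence strictly convex, with at
most two zeros and negative values between two of them. With at least three exponents no two defects
are nonpositive at the same point. So the complement of `R_f` is a disjoint union of the sets where
a single defect is negative, and each such set is an interval bounded by solutions of one equation.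
-/

open scoped BoundedContinuousFunction

noncomputable section

/-! ### Almost periodic functions on the line in the sense of Bochner -/

namespace AlmostPeriodic

/-- The translate `x ↦ g (x + t)` of a bounded continuous function. -/
def translate (t : ℝ) (g : ℝ →ᵇ ℂ) : ℝ →ᵇ ℂ :=
  g.compContinuous ⟨fun x => x + t, by fun_prop⟩

@[simp]
theorem translate_apply (t : ℝ) (g : ℝ →ᵇ ℂ) (x : ℝ) : translate t g x = g (x + t) := rfl

/-- Almost periodicity in the sense of Bochner: the translates lie in a compact set. -/
def IsAP (g : ℝ →ᵇ ℂ) : Prop :=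
  ∃ K : Set (ℝ →ᵇ ℂ), IsCompact K ∧ ∀ t, translate t g ∈ K

theorem IsAP.mul {g h : ℝ →ᵇ ℂ} (hg : IsAP g) (hh : IsAP h) : IsAP (g * h) := by
  obtain ⟨K, hK, hgK⟩ := hg
  obtain ⟨L, hL, hhL⟩ := hh
  refine ⟨(fun p : (ℝ →ᵇ ℂ) × (ℝ →ᵇ ℂ) => p.1 * p.2) '' (K ×ˢ L),
    (hK.prod hL).image (by fun_prop), fun t => ⟨(translate t g, translate t h),
      ⟨hgK t, hhL t⟩, ?_⟩⟩
  ext x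
  simp

theorem IsAP.sub {g h : ℝ →ᵇ ℂ} (hg : IsAP g) (hh : IsAP h) : IsAP (g - h) := by
  obtain ⟨K, hK, hgK⟩ := hg
  obtain ⟨L, hL, hhL⟩ := hh
  refine ⟨(fun p : (ℝ →ᵇ ℂ) × (ℝ →ᵇ ℂ) => p.1 - p.2) '' (K ×ˢ L),
    (hK.prod hL).image (by fun_prop), fun t => ⟨(translate t g, translate t h),
      ⟨hgK t, hhL t⟩, ?_⟩⟩
  ext x
  simp

theorem translate_translate (s t : ℝ) (g : ℝ →ᵇ ℂ) :
    translate s (translate t g) = translate (s + t) g := by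
  ext x
  simp [add_assoc]

theorem IsAP.comp_translate {g : ℝ →ᵇ ℂ} (hg : IsAP g) (s : ℝ) : IsAP (translate s g) := by
  obtain ⟨K, hK, hgK⟩ := hg
  exact ⟨K, hK, fun t => by rw [translate_translate]; exact hgK _⟩

theorem norm_translate_sub_translate_le (s t r : ℝ) (g : ℝ →ᵇ ℂ) :
    ‖translate (s + t) g - translate (s + r) g‖ ≤ ‖translate t g - translate r g‖ := by
  rw [BoundedContinuousFunction.norm_le (norm_nonneg _)]
  intro x
  have := (translate t g - translate r g).norm_coe_le_norm (x + s)
  simpa [add_assoc] using this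

/-- The exponential `t ↦ e^{iμt}`. -/
def expi (μ : ℝ) : ℝ →ᵇ ℂ :=
  BoundedContinuousFunction.ofNormedAddCommGroup (fun t : ℝ => Complex.exp (μ * t * Complex.I))
    (by fun_prop) 1 (fun t => by
      rw [← Complex.ofReal_mul, Complex.norm_exp_ofReal_mul_I])

@[simp]
theorem expi_apply (μ t : ℝ) : expi μ t = Complex.exp (μ * t * Complex.I) := rfl

theorem norm_expi_apply (μ t : ℝ) : ‖expi μ t‖ = 1 := by
  rw [expi_apply, ← Complex.ofReal_mul, Complex.norm_exp_ofReal_mul_I]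

theorem norm_expi (μ : ℝ) : ‖expi μ‖ ≤ 1 :=
  (BoundedContinuousFunction.norm_le zero_le_one).2 fun t => (norm_expi_apply μ t).le

theorem expi_add_apply (μ s t : ℝ) : expi μ (s + t) = expi μ t * expi μ s := by
  simp only [expi_apply]
  rw [← Complex.exp_add]
  congr 1
  push_cast
  ring

/-- Translation by `t` only multiplies each coefficient by a unimodular number. All translates
therefore lie in the image of a product of circles, compact by Tychonoff, under a map that is
continuous because `∑ ‖c i‖` dominates. -/
theorem isAP_tsum {ι : Type*} (μ : ι → ℝ) (c : ι → ℂ) (hc : Summable fun i => ‖c i‖) :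
    IsAP (∑' i, c i • expi (μ i)) := by
  have hb : ∀ (i : ι) (z : ι → Circle), ‖((z i : ℂ) * c i) • expi (μ i)‖ ≤ ‖c i‖ := by
    intro i z
    rw [norm_smul, norm_mul, Circle.norm_coe, one_mul]
    exact mul_le_of_le_one_right (norm_nonneg _) (norm_expi _)
  have hs : ∀ z : ι → Circle, Summable fun i => ((z i : ℂ) * c i) • expi (μ i) := fun z =>
    Summable.of_norm_bounded hc fun i => hb i z
  have hcont : Continuous fun z : ι → Circle => ∑' i, ((z i : ℂ) * c i) • expi (μ i) := by
    refine continuous_tsum (fun i => ?_) hc fun i z => hb i z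
    fun_prop
  refine ⟨_, isCompact_range hcont, fun t => ⟨fun i => Circle.exp (μ i * t), ?_⟩⟩
  have h1 : Summable fun i => c i • expi (μ i) := by simpa using hs 1
  ext x
  have e1 := ((BoundedContinuousFunction.evalCLM ℂ x).hasSum
    (hs fun i => Circle.exp (μ i * t)).hasSum)
  have e2 := ((BoundedContinuousFunction.evalCLM ℂ (x + t)).hasSum h1.hasSum)
  refine e1.unique ?_
  convert! e2 using 2 with i
  simp only [BoundedContinuousFunction.evalCLM_apply,
    BoundedContinuousFunction.coe_smul, smul_eq_mul, expi_add_apply]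
  simp only [Circle.coe_exp, expi_apply]
  push_cast
  ring

theorem isAP_expi (μ : ℝ) : IsAP (expi μ) := by
  have := isAP_tsum (fun _ : Unit => μ) (fun _ => 1) (Summable.of_finite)
  simpa using this

/-! ### Bohr's definition and Bochner's definition -/

theorem uniformContinuous_of_bohr (g : ℝ →ᵇ ℂ)
    (h : ∀ ε : ℝ, 0 < ε → ∃ l : ℝ, 0 < l ∧ ∀ t₀ : ℝ, ∃ τ ∈ Ioo t₀ (t₀ + l),
      ∀ x, ‖g (x + τ) - g x‖ ≤ ε) : UniformContinuous g := by
  rw [Metric.uniformContinuous_iff]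
  intro ε hε
  obtain ⟨l, hl, hτ⟩ := h (ε / 4) (by positivity)
  have hu := isCompact_Icc.uniformContinuousOn_of_continuous
    (s := Icc (-1) (l + 1)) g.continuous.continuousOn
  rw [Metric.uniformContinuousOn_iff] at hu
  obtain ⟨δ, hδ, hu⟩ := hu (ε / 4) (by positivity)
  -- An almost period carries `a` into `(0, l)`; the cap `1` keeps the shifted `b` inside `[-1, l +
  -- 1]`, where uniform continuity is available.
  refine ⟨min δ 1, by positivity, fun a b hab => ?_⟩
  obtain ⟨τ, ⟨h1, h2⟩, h3⟩ := hτ (-a)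
  have hd := lt_min_iff.1 hab
  rw [Real.dist_eq, abs_lt, abs_lt] at hd
  have := hu (a + τ) ⟨by linarith, by linarith⟩ (b + τ)
    ⟨by linarith [hd.2.2], by linarith [hd.2.1]⟩ (by
    rw [Real.dist_eq, add_sub_add_right_eq_sub, abs_lt]
    exact hd.1)
  rw [dist_eq_norm] at this ⊢
  calc ‖g a - g b‖ = ‖(g (a + τ) - g (b + τ)) - (g (a + τ) - g a) + (g (b + τ) - g b)‖ := by
        congr 1; ring
    _ ≤ ‖g (a + τ) - g (b + τ)‖ + ‖g (a + τ) - g a‖ + ‖g (b + τ) - g b‖ :=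
        (norm_add_le _ _).trans (add_le_add_left (norm_sub_le _ _) _)
    _ < ε := by linarith [h3 a, h3 b]

theorem continuous_translate {g : ℝ →ᵇ ℂ} (hg : UniformContinuous g) :
    Continuous fun t => translate t g := by
  rw [Metric.continuous_iff]
  intro t ε hε
  obtain ⟨δ, hδ, h⟩ := Metric.uniformContinuous_iff.1 hg (ε / 2) (by positivity)
  refine ⟨δ, hδ, fun s hs => lt_of_le_of_lt ?_ (half_lt_self hε)⟩
  rw [BoundedContinuousFunction.dist_le (by positivity)]
  intro x
  exact (h (by simpa using hs)).le

/-- The translates by `t` in `[0, l]` form a compact piece of the orbit, and an almost period moves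
any other translate within `ε / 4` of this piece. So the orbit is totally bounded. -/
theorem isAP_of_bohr (g : ℝ →ᵇ ℂ)
    (h : ∀ ε : ℝ, 0 < ε → ∃ l : ℝ, 0 < l ∧ ∀ t₀ : ℝ, ∃ τ ∈ Ioo t₀ (t₀ + l),
      ∀ x, ‖g (x + τ) - g x‖ ≤ ε) : IsAP g := by
  have hc := continuous_translate (uniformContinuous_of_bohr g h)
  refine ⟨closure (range fun t => translate t g), ?_, fun t => subset_closure ⟨t, rfl⟩⟩
  refine TotallyBounded.isCompact_of_isClosed (TotallyBounded.closure ?_) isClosed_closure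
  rw [Metric.totallyBounded_iff]
  intro ε hε
  obtain ⟨l, hl, hτ⟩ := h (ε / 4) (by positivity)
  have hK := (isCompact_Icc (a := (0 : ℝ)) (b := l)).image hc
  obtain ⟨F, hF, hcov⟩ := Metric.totallyBounded_iff.1 hK.totallyBounded (ε / 2) (by positivity)
  refine ⟨F, hF, ?_⟩
  rintro _ ⟨t, rfl⟩
  obtain ⟨τ, ⟨h1, h2⟩, h3⟩ := hτ (-t)
  have hm := hcov ⟨t + τ, ⟨by linarith, by linarith⟩, rfl⟩
  simp only [mem_iUnion, Metric.mem_ball, exists_prop] at hm ⊢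
  obtain ⟨y, hy, hd⟩ := hm
  refine ⟨y, hy, ?_⟩
  have : dist (translate t g) (translate (t + τ) g) ≤ ε / 4 := by
    rw [BoundedContinuousFunction.dist_le (by positivity)]
    intro x
    rw [dist_comm, dist_eq_norm]
    simpa [add_assoc] using h3 (x + t)
  linarith [dist_triangle (translate t g) (translate (t + τ) g) y]

/-- A finite net of the orbit can be centred at points of the orbit, and `L` bounds their
parameters. This is how an arbitrary translation is traded for a bounded one. -/
theorem IsAP.exists_bounded_net {g : ℝ →ᵇ ℂ} (hg : IsAP g) {ε : ℝ} (hε : 0 < ε) :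
    ∃ L : ℝ, 0 < L ∧ ∀ t, ∃ r, |r| ≤ L ∧ ‖translate t g - translate r g‖ ≤ ε := by
  obtain ⟨K, hK, hgK⟩ := hg
  have htb : TotallyBounded (range fun t => translate t g) :=
    hK.totallyBounded.subset (by rintro _ ⟨t, rfl⟩; exact hgK t)
  obtain ⟨F, hFs, hF, hcov⟩ := htb.exists_subset (Metric.dist_mem_uniformity hε)
  choose! ρ hρ using fun y (hy : y ∈ F) => mem_range.1 (hFs hy)
  obtain ⟨L, hL⟩ := (hF.image fun y => |ρ y|).bddAbove
  refine ⟨max L 1, by positivity, fun t => ?_⟩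
  obtain ⟨y, hy, hd⟩ := mem_iUnion₂.1 (hcov ⟨t, rfl⟩)
  refine ⟨ρ y, (hL ⟨y, hy, rfl⟩).trans (le_max_left _ _), ?_⟩
  have : translate (ρ y) g = y := hρ y hy
  rw [this, ← dist_eq_norm]
  exact le_of_lt hd

theorem IsAP.uniformContinuous {g : ℝ →ᵇ ℂ} (hg : IsAP g) : UniformContinuous g := by
  refine uniformContinuous_of_bohr g fun ε hε => ?_
  obtain ⟨L, hL, h⟩ := hg.exists_bounded_net hε
  refine ⟨4 * L, by positivity, fun t₀ => ?_⟩
  obtain ⟨r, hr, h⟩ := h (t₀ + 2 * L)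
  have hr' := abs_le.1 hr
  -- If translation by `t₀ + 2L` nearly agrees with translation by `r`, then the difference of the
  -- two is an almost period; it lies in the window because `|r| ≤ L`.
  refine ⟨t₀ + 2 * L - r, ⟨by linarith, by linarith⟩, fun x => ?_⟩
  have := (translate (t₀ + 2 * L) g
    - translate r g).norm_coe_le_norm (x - r)
  simp only [BoundedContinuousFunction.coe_sub, Pi.sub_apply, translate_apply,
    sub_add_cancel] at this
  rw [show x + (t₀ + 2 * L - r) = x - r + (t₀ + 2 * L) by ring]
  linarith

/-! ### Mean values -/

/-- `m` is the mean value of `g`, uniformly over all intervals of a given large length. -/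
def HasMean (g : ℝ → ℂ) (m : ℂ) : Prop :=
  ∀ ε : ℝ, 0 < ε → ∃ T₀ : ℝ, 0 < T₀ ∧ ∀ T, T₀ ≤ T → ∀ a : ℝ,
    ‖(∫ t in a..a + T, g t) - T * m‖ ≤ ε * T

/-- Cut the interval into blocks of length `T`; what is left is shorter than `T` and costs at most
`T * B`. -/
theorem norm_integral_le_of_norm_integral_block_le {h : ℝ → ℂ} (hc : Continuous h) {B T ε : ℝ}
    (hB : ∀ t, ‖h t‖ ≤ B) (hT : 0 < T) (hε : 0 ≤ ε)
    (hbl : ∀ a : ℝ, ‖∫ t in a..a + T, h t‖ ≤ ε * T) {S : ℝ} (hS : 0 ≤ S) (a : ℝ) :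
    ‖∫ t in a..a + S, h t‖ ≤ ε * S + T * B := by
  have hB0 : 0 ≤ B := (norm_nonneg _).trans (hB 0)
  have key : ∀ n : ℕ, ∀ S : ℝ, 0 ≤ S → S < (n + 1) * T → ∀ a : ℝ,
      ‖∫ t in a..a + S, h t‖ ≤ ε * S + T * B := by
    have hsmall : ∀ S : ℝ, 0 ≤ S → S < T → ∀ a : ℝ,
        ‖∫ t in a..a + S, h t‖ ≤ ε * S + T * B := by
      intro S hS hST a
      have := intervalIntegral.norm_integral_le_of_norm_le_const (a := a) (b := a + S)
        (f := h) (C := B) (fun t _ => hB t)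
      rw [add_sub_cancel_left, abs_of_nonneg hS] at this
      nlinarith [mul_nonneg hε hS]
    intro n
    induction n with
    | zero => simpa using hsmall
    | succ n ih =>
      intro S hS hSn a
      rcases lt_or_ge S T with hST | hST
      · exact hsmall S hS hST a
      · have h1 := ih (S - T) (by linarith) (by push_cast at hSn; linarith) (a + T)
        rw [show a + T + (S - T) = a + S by ring] at h1
        rw [← intervalIntegral.integral_add_adjacent_intervals (b := a + T)
          (hc.intervalIntegrable _ _) (hc.intervalIntegrable _ _)]
        linarith [norm_add_le (∫ t in a..a + T, h t) (∫ t in a + T..a + S, h t), hbl a]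
  obtain ⟨n, hn⟩ := exists_nat_gt (S / T)
  refine key n S hS ?_ a
  rw [div_lt_iff₀ hT] at hn
  linarith

theorem norm_integral_sub_le_of_block {h : ℝ → ℂ} (hc : Continuous h) {B T ε : ℝ} {c : ℂ}
    (hB : ∀ t, ‖h t‖ ≤ B) (hT : 0 < T) (hε : 0 ≤ ε)
    (hbl : ∀ a : ℝ, ‖(∫ t in a..a + T, h t) - T * c‖ ≤ ε * T) {S : ℝ} (hS : 0 ≤ S) (a : ℝ) :
    ‖(∫ t in a..a + S, h t) - S * c‖ ≤ ε * S + T * (B + ‖c‖) := by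
  have hi : ∀ a S : ℝ, ∫ t in a..a + S, (h t - c) = (∫ t in a..a + S, h t) - S * c := by
    intro a S
    rw [intervalIntegral.integral_sub (hc.intervalIntegrable _ _)
      (continuous_const.intervalIntegrable _ _)]
    simp
  rw [← hi]
  refine norm_integral_le_of_norm_integral_block_le (h := fun t => h t - c)
    (hc.sub continuous_const) (fun t => (norm_sub_le _ _).trans (add_le_add_left (hB t) _)) hT hε (fun a => ?_) hS a
  rw [hi]
  exact hbl a

/-- The window at `a` may be replaced by the window at some `r` with `|r| ≤ L`, at a cost `ε / 2`
per unit length. The windows at `r` and at `0` differ only in two end pieces of length at most `L`,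
negligible for large `T`. -/
theorem IsAP.norm_integral_sub_integral_le {g : ℝ →ᵇ ℂ} (hg : IsAP g) {ε : ℝ} (hε : 0 < ε) :
    ∃ T₀ : ℝ, 0 < T₀ ∧ ∀ T, T₀ ≤ T → ∀ a : ℝ,
      ‖(∫ t in a..a + T, g t) - ∫ t in (0 : ℝ)..T, g t‖ ≤ ε * T := by
  obtain ⟨L, hL, hnet⟩ := hg.exists_bounded_net (half_pos hε)
  refine ⟨4 * L * (‖g‖ + 1) / ε, by positivity, fun T hT a => ?_⟩
  have hT0 : 0 < T := lt_of_lt_of_le (by positivity) hT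
  obtain ⟨r, hr, h⟩ := hnet a
  have hi : ∀ x y : ℝ, IntervalIntegrable g MeasureTheory.volume x y := fun x y =>
    g.continuous.intervalIntegrable _ _
  have e1 : ∀ b : ℝ, ∫ t in b..b + T, g t = ∫ t in (0 : ℝ)..T, translate b g t := by
    intro b
    simp only [translate_apply]
    rw [intervalIntegral.integral_comp_add_right (fun t => g t)]
    simp [add_comm]
  have e2 : ‖(∫ t in a..a + T, g t) - ∫ t in r..r + T, g t‖ ≤ ε / 2 * T := by
    rw [e1, e1, ← intervalIntegral.integral_sub ((translate a g).continuous.intervalIntegrable _ _)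
      ((translate r g).continuous.intervalIntegrable _ _)]
    have := intervalIntegral.norm_integral_le_of_norm_le_const (a := 0) (b := T)
      (f := fun t => translate a g t - translate r g t) (C := ε / 2)
      (fun t _ => ((translate a g - translate r g).norm_coe_le_norm t).trans h)
    simpa [abs_of_pos hT0] using this
  have e3 : (∫ t in r..r + T, g t) - ∫ t in (0 : ℝ)..T, g t
      = (∫ t in T..r + T, g t) - ∫ t in (0 : ℝ)..r, g t := by
    have := intervalIntegral.integral_interval_sub_interval_comm (hi r (r + T)) (hi 0 T) (hi r 0)
    rw [this, intervalIntegral.integral_symm 0 r, intervalIntegral.integral_symm T (r + T)]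
    ring
  have hb : ∀ x y : ℝ, ‖∫ t in x..y, g t‖ ≤ ‖g‖ * |y - x| := fun x y =>
    intervalIntegral.norm_integral_le_of_norm_le_const fun t _ => g.norm_coe_le_norm t
  have e4 : ‖(∫ t in r..r + T, g t) - ∫ t in (0 : ℝ)..T, g t‖ ≤ 2 * (‖g‖ * L) := by
    rw [e3]
    have h1 := hb T (r + T)
    have h2 := hb 0 r
    rw [add_sub_cancel_right] at h1
    rw [sub_zero] at h2
    have h3 := mul_le_mul_of_nonneg_left hr (norm_nonneg g)
    linarith [norm_sub_le (∫ t in T..r + T, g t) (∫ t in (0 : ℝ)..r, g t)]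
  have e5 : 2 * (‖g‖ * L) ≤ ε / 2 * T := by
    rw [div_le_iff₀ hε] at hT
    nlinarith
  have := norm_add_le ((∫ t in a..a + T, g t) - ∫ t in r..r + T, g t)
    ((∫ t in r..r + T, g t) - ∫ t in (0 : ℝ)..T, g t)
  rw [sub_add_sub_cancel] at this
  linarith

theorem IsAP.exists_hasMean {g : ℝ →ᵇ ℂ} (hg : IsAP g) : ∃ m, HasMean g m := by
  set A : ℝ → ℂ := fun T => (∫ t in (0 : ℝ)..T, g t) / T with hA
  have hAT : ∀ T : ℝ, 0 < T → (T : ℂ) * A T = ∫ t in (0 : ℝ)..T, g t := by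
    intro T hT
    have : (T : ℂ) ≠ 0 := by exact_mod_cast hT.ne'
    simp only [hA]
    field_simp
  -- the means over long intervals are close to the mean over one sufficiently long interval
  have key : ∀ ε : ℝ, 0 < ε → ∃ T : ℝ, 0 < T ∧ ∃ S₀ : ℝ, 0 < S₀ ∧ ∀ S, S₀ ≤ S → ∀ a : ℝ,
      ‖(∫ t in a..a + S, g t) - S * A T‖ ≤ ε * S := by
    intro ε hε
    obtain ⟨T, hT, h⟩ := hg.norm_integral_sub_integral_le (half_pos hε)
    have hbl : ∀ a : ℝ, ‖(∫ t in a..a + T, g t) - T * A T‖ ≤ ε / 2 * T := by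
      intro a
      rw [hAT T hT]
      exact h T le_rfl a
    refine ⟨T, hT, 2 * T * (‖g‖ + ‖A T‖ + 1) / ε, by positivity, fun S hS a => ?_⟩
    have hS0 : 0 < S := lt_of_lt_of_le (by positivity) hS
    have := norm_integral_sub_le_of_block g.continuous g.norm_coe_le_norm hT (half_pos hε).le
      hbl hS0.le a
    rw [div_le_iff₀ hε] at hS
    nlinarith
  have hdist : ∀ S T ε : ℝ, 0 < S → ‖(∫ t in (0 : ℝ)..0 + S, g t) - S * A T‖ ≤ ε * S →
      ‖A S - A T‖ ≤ ε := by
    intro S T ε hS h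
    rw [zero_add, ← hAT S hS, ← mul_sub, norm_mul, Complex.norm_real, Real.norm_eq_abs,
      abs_of_pos hS, mul_comm] at h
    exact le_of_mul_le_mul_right h hS
  have hcau : CauchySeq A := by
    rw [Metric.cauchySeq_iff']
    intro ε hε
    obtain ⟨T, -, S₀, hS₀, h⟩ := key (ε / 4) (by positivity)
    refine ⟨S₀, fun S hS => ?_⟩
    have h1 := hdist S T _ (hS₀.trans_le hS) (h S hS 0)
    have h2 := hdist S₀ T _ hS₀ (h S₀ le_rfl 0)
    rw [dist_eq_norm]
    have := norm_sub_le (A S - A T) (A S₀ - A T)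
    rw [sub_sub_sub_cancel_right] at this
    linarith
  obtain ⟨m, hm⟩ := cauchySeq_tendsto_of_complete hcau
  refine ⟨m, fun ε hε => ?_⟩
  obtain ⟨T, hT, S₀, hS₀, h⟩ := key (ε / 2) (by positivity)
  have hTm : ‖m - A T‖ ≤ ε / 2 := by
    refine le_of_tendsto ((hm.sub_const (A T)).norm) ?_
    filter_upwards [eventually_ge_atTop S₀] with S hS
    exact hdist S T _ (hS₀.trans_le hS) (h S hS 0)
  refine ⟨S₀, hS₀, fun S hS a => ?_⟩
  have hS0 := hS₀.trans_le hS
  have e : (∫ t in a..a + S, g t) - S * m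
      = ((∫ t in a..a + S, g t) - S * A T) - S * (m - A T) := by ring
  rw [e]
  refine (norm_sub_le _ _).trans ?_
  rw [norm_mul, Complex.norm_real, Real.norm_eq_abs, abs_of_pos hS0]
  nlinarith [h S hS a]

theorem HasMean.tendsto {g : ℝ → ℂ} {m : ℂ} (h : HasMean g m) :
    Tendsto (fun T : ℝ => (1 / (2 * T) : ℂ) * ∫ t in (-T)..T, g t) atTop (𝓝 m) := by
  rw [Metric.tendsto_atTop]
  intro ε hε
  obtain ⟨T₀, hT₀, h⟩ := h (ε / 2) (by positivity)
  refine ⟨T₀, fun T hT => ?_⟩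
  have hT0 : 0 < T := hT₀.trans_le hT
  have := h (2 * T) (by linarith) (-T)
  rw [show -T + 2 * T = T by ring] at this
  have hTc : (T : ℂ) ≠ 0 := by exact_mod_cast hT0.ne'
  rw [dist_eq_norm, show (1 / (2 * T) : ℂ) * (∫ t in (-T)..T, g t) - m
    = (1 / (2 * T) : ℂ) * ((∫ t in (-T)..T, g t) - (2 * T : ℝ) * m) by
      push_cast; field_simp, norm_mul]
  have hn : ‖(1 / (2 * T) : ℂ)‖ = 1 / (2 * T) := by
    rw [show (1 / (2 * T) : ℂ) = ((1 / (2 * T) : ℝ) : ℂ) by push_cast; ring, Complex.norm_real,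
      Real.norm_eq_abs, abs_of_pos (by positivity)]
  rw [hn]
  calc _ ≤ 1 / (2 * T) * (ε / 2 * (2 * T)) := by gcongr
    _ = ε / 2 := by field_simp
    _ < ε := by linarith

theorem HasMean.unique {g : ℝ → ℂ} {m m' : ℂ} (h : HasMean g m) (h' : HasMean g m') : m = m' :=
  tendsto_nhds_unique h.tendsto h'.tendsto

theorem HasMean.const_mul {g : ℝ → ℂ} {m : ℂ} (h : HasMean g m) (c : ℂ) :
    HasMean (fun t => c * g t) (c * m) := by
  intro ε hε
  obtain ⟨T₀, hT₀, h⟩ := h (ε / (‖c‖ + 1)) (by positivity)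
  refine ⟨T₀, hT₀, fun T hT a => ?_⟩
  rw [intervalIntegral.integral_const_mul, show c * (∫ t in a..a + T, g t) - T * (c * m)
    = c * ((∫ t in a..a + T, g t) - T * m) by ring, norm_mul]
  have hT0 : 0 < T := hT₀.trans_le hT
  calc _ ≤ (‖c‖ + 1) * (ε / (‖c‖ + 1) * T) := by
        gcongr
        · linarith
        · exact h T hT a
    _ = ε * T := by field_simp

theorem HasMean.add {g h : ℝ → ℂ} {m n : ℂ} (hg : Continuous g) (hh : Continuous h)
    (hm : HasMean g m) (hn : HasMean h n) : HasMean (fun t => g t + h t) (m + n) := by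
  intro ε hε
  obtain ⟨T₀, hT₀, h1⟩ := hm (ε / 2) (by positivity)
  obtain ⟨T₁, hT₁, h2⟩ := hn (ε / 2) (by positivity)
  refine ⟨max T₀ T₁, by positivity, fun T hT a => ?_⟩
  rw [intervalIntegral.integral_add (hg.intervalIntegrable _ _) (hh.intervalIntegrable _ _),
    mul_add, add_sub_add_comm]
  have h1 := h1 T ((le_max_left _ _).trans hT) a
  have h2 := h2 T ((le_max_right _ _).trans hT) a
  exact (norm_add_le _ _).trans (by linarith)

theorem hasMean_zero : HasMean (fun _ => 0) 0 :=
  fun ε hε => ⟨1, one_pos, fun T hT a => by simpa using by positivity⟩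

theorem HasMean.sum {ι : Type*} (s : Finset ι) {g : ι → ℝ → ℂ} {m : ι → ℂ}
    (hg : ∀ i ∈ s, Continuous (g i)) (h : ∀ i ∈ s, HasMean (g i) (m i)) :
    HasMean (fun t => ∑ i ∈ s, g i t) (∑ i ∈ s, m i) := by
  classical
  induction s using Finset.induction_on with
  | empty => simpa using hasMean_zero
  | insert i s hi ih =>
    simp only [Finset.sum_insert hi]
    refine HasMean.add (hg i (Finset.mem_insert_self _ _))
      (continuous_finsetSum _ fun j hj => hg j (Finset.mem_insert_of_mem hj))
      (h i (Finset.mem_insert_self _ _))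
      (ih (fun j hj => hg j (Finset.mem_insert_of_mem hj))
        fun j hj => h j (Finset.mem_insert_of_mem hj))

theorem hasMean_expi_zero : HasMean (expi 0) 1 := by
  intro ε hε
  refine ⟨1, one_pos, fun T hT a => ?_⟩
  simpa using by positivity

theorem hasMean_expi_of_ne_zero {μ : ℝ} (hμ : μ ≠ 0) : HasMean (expi μ) 0 := by
  intro ε hε
  refine ⟨2 / (|μ| * ε), by positivity, fun T hT a => ?_⟩
  have hc : (μ * Complex.I : ℂ) ≠ 0 := by simpa using hμ
  have := integral_exp_mul_complex (a := a) (b := a + T) hc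
  have hrw : ∀ t : ℝ, expi μ t = Complex.exp (μ * Complex.I * t) := fun t => by
    rw [expi_apply]; ring_nf
  simp only [hrw, mul_zero, sub_zero]
  rw [this, norm_div]
  have hn : ∀ t : ℝ, ‖Complex.exp (μ * Complex.I * t)‖ = 1 := fun t => by
    rw [← hrw, norm_expi_apply]
  have h2 : ‖Complex.exp (μ * Complex.I * (a + T : ℝ)) - Complex.exp (μ * Complex.I * a)‖ ≤ 2 := by
    refine (norm_sub_le _ _).trans ?_
    rw [hn, hn]; norm_num
  rw [norm_mul, Complex.norm_I, mul_one, Complex.norm_real, Real.norm_eq_abs]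
  have hμ' : 0 < |μ| := abs_pos.2 hμ
  rw [div_le_iff₀ (by positivity)] at hT ⊢
  linarith

/-- Meant for a weight `κ` that is a Riesz product: its mean is known although its supremum is
useless. -/
theorem HasMean.norm_le_mul {g k : ℝ → ℂ} {κ : ℝ → ℝ} {m : ℂ} {M C : ℝ} (hg : HasMean g m)
    (hk : HasMean k M) (hκc : Continuous κ) (hκ : ∀ t, k t = κ t)
    (h : ∀ t, ‖g t‖ ≤ C * κ t) : ‖m‖ ≤ C * M := by
  have h1 := hg.tendsto.norm
  have h2 : Tendsto (fun T : ℝ => C * (1 / (2 * T) * ∫ t in (-T)..T, κ t)) atTop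
      (𝓝 (C * M)) := by
    refine Tendsto.const_mul C ?_
    have := (Complex.continuous_re.tendsto _).comp hk.tendsto
    rw [Complex.ofReal_re] at this
    refine this.congr fun T => ?_
    simp only [Function.comp, hκ]
    rw [intervalIntegral.integral_ofReal]
    norm_cast
  refine le_of_tendsto_of_tendsto h1 h2 ?_
  filter_upwards [eventually_gt_atTop 0] with T hT
  have hn : ‖(1 / (2 * T) : ℂ)‖ = 1 / (2 * T) := by
    rw [show (1 / (2 * T) : ℂ) = ((1 / (2 * T) : ℝ) : ℂ) by push_cast; ring, Complex.norm_real,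
      Real.norm_eq_abs, abs_of_pos (by positivity)]
  rw [norm_mul, hn, mul_left_comm, ← intervalIntegral.integral_const_mul]
  gcongr
  exact intervalIntegral.norm_integral_le_of_norm_le (by linarith)
    (Eventually.of_forall fun t _ => h t) ((continuous_const.mul hκc).intervalIntegrable _ _)

/-! ### A convolution estimate on the circle -/

section Circle

open MeasureTheory AddCircle

variable {P : ℝ} [hP : Fact (0 < P)]

theorem hasSum_sq_fourierCoeff_of_bound {w : AddCircle P → ℂ} (hw : StronglyMeasurable w) {C : ℝ}
    (hC : ∀ x, ‖w x‖ ≤ C) :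
    HasSum (fun n : ℤ => ‖fourierCoeff w n‖ ^ 2) (∫ x, ‖w x‖ ^ 2 ∂haarAddCircle) := by
  have hm : MemLp w 2 (haarAddCircle (T := P)) :=
    MemLp.of_bound hw.aestronglyMeasurable C (Eventually.of_forall hC)
  have h := hasSum_sq_fourierCoeff (hm.toLp w)
  rw [fourierCoeff_congr_ae hm.coeFn_toLp] at h
  convert! h using 1
  refine integral_congr_ae ?_
  filter_upwards [hm.coeFn_toLp] with x hx
  rw [hx]

theorem fourierCoeff_conv {v g : AddCircle P → ℂ} (hv : StronglyMeasurable v)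
    (hg : StronglyMeasurable g) {A B : ℝ} (hA : ∀ x, ‖v x‖ ≤ A) (hB : ∀ x, ‖g x‖ ≤ B) (n : ℤ) :
    fourierCoeff (fun x => ∫ z, v z * g (x - z) ∂haarAddCircle) n
      = fourierCoeff v n * fourierCoeff g n := by
  have hA0 : 0 ≤ A := (norm_nonneg _).trans (hA 0)
  simp only [fourierCoeff, smul_eq_mul]
  have h0 : ∀ x : AddCircle P, fourier (-n) x * ∫ z, v z * g (x - z) ∂haarAddCircle
      = ∫ z, fourier (-n) x * (v z * g (x - z)) ∂haarAddCircle := fun x =>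
    (integral_const_mul _ _).symm
  simp only [h0]
  rw [integral_integral_swap]
  · rw [← integral_mul_const]
    refine integral_congr_ae (Eventually.of_forall fun z => ?_)
    have h := integral_sub_right_eq_self (μ := haarAddCircle (T := P))
      (fun x => fourier (-n) (x + z) * (v z * g x)) z
    simp only [sub_add_cancel] at h
    beta_reduce
    rw [h, ← integral_const_mul]
    refine integral_congr_ae (Eventually.of_forall fun x => ?_)
    have : fourier (-n) (x + z) = fourier (-n) x * fourier (-n) z := by
      simp only [fourier_apply, smul_add, toCircle_add, Circle.coe_mul]
    simp only [this]
    ring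
  · refine Integrable.of_bound (C := A * B) ?_ (Eventually.of_forall fun p => ?_)
    · refine StronglyMeasurable.aestronglyMeasurable ?_
      have h1 : StronglyMeasurable fun p : AddCircle P × AddCircle P => fourier (-n) p.1 :=
        ((fourier (-n)).continuous.comp continuous_fst).stronglyMeasurable
      have h2 : StronglyMeasurable fun p : AddCircle P × AddCircle P => v p.2 :=
        hv.comp_measurable measurable_snd
      have h3 : StronglyMeasurable fun p : AddCircle P × AddCircle P => g (p.1 - p.2) :=
        hg.comp_measurable (measurable_fst.sub measurable_snd)
      exact h1.mul (h2.mul h3)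
    · simp only [Function.uncurry, norm_mul, fourier_apply, Circle.norm_coe, one_mul]
      exact mul_le_mul (hA _) (hB _) (norm_nonneg _) hA0

/-- The convolution `v * g` has coefficients `v̂ ĝ`, so by Parseval its `L²` norm is at most `S`
times that of `v`, hence at most `A * S`. Its `L¹` norm is no larger on a probability space, and `u`
contributes another factor `A`. -/
theorem norm_integral_mul_conv_le {u v g : AddCircle P → ℂ}
    (hv : StronglyMeasurable v) (hg : StronglyMeasurable g) {A B S : ℝ}
    (hu : ∀ x, ‖u x‖ ≤ A) (hA : ∀ x, ‖v x‖ ≤ A) (hB : ∀ x, ‖g x‖ ≤ B)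
    (hS : ∀ n : ℤ, ‖fourierCoeff g n‖ ≤ S) :
    ‖∫ x, u x * ∫ z, v z * g (x - z) ∂haarAddCircle ∂haarAddCircle‖ ≤ A ^ 2 * S := by
  have hA0 : 0 ≤ A := (norm_nonneg _).trans (hA 0)
  have hS0 : 0 ≤ S := (norm_nonneg _).trans (hS 0)
  set w : AddCircle P → ℂ := fun x => ∫ z, v z * g (x - z) ∂haarAddCircle with hw
  have hwm : StronglyMeasurable w :=
    StronglyMeasurable.integral_prod_right ((hv.comp_measurable measurable_snd).mul
      (hg.comp_measurable (measurable_fst.sub measurable_snd)))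
  have hwb : ∀ x, ‖w x‖ ≤ A * B := by
    intro x
    have := norm_integral_le_of_norm_le_const (μ := haarAddCircle (T := P)) (C := A * B)
      (f := fun z => v z * g (x - z)) (Eventually.of_forall fun z => by
        rw [norm_mul]
        exact mul_le_mul (hA _) (hB _) (norm_nonneg _) hA0)
    simpa using this
  have h2 : ∫ x, ‖w x‖ ^ 2 ∂haarAddCircle ≤ (A * S) ^ 2 := by
    have e1 := hasSum_sq_fourierCoeff_of_bound hwm hwb
    have e2 := (hasSum_sq_fourierCoeff_of_bound hv hA).mul_right (S ^ 2)
    have e3 : ∫ x, ‖v x‖ ^ 2 ∂(haarAddCircle (T := P)) ≤ A ^ 2 := by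
      have := norm_integral_le_of_norm_le_const (μ := haarAddCircle (T := P)) (C := A ^ 2)
        (f := fun z => ‖v z‖ ^ 2) (Eventually.of_forall fun z => by
          rw [norm_pow, norm_norm]
          exact pow_le_pow_left₀ (norm_nonneg _) (hA z) 2)
      simp only [probReal_univ, mul_one] at this
      exact (le_abs_self _).trans this
    calc _ ≤ (∫ x, ‖v x‖ ^ 2 ∂(haarAddCircle (T := P))) * S ^ 2 := by
          refine hasSum_le (fun n => ?_) e1 e2
          rw [hw, fourierCoeff_conv hv hg hA hB, norm_mul, mul_pow]
          gcongr
          exact hS n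
      _ ≤ A ^ 2 * S ^ 2 := by gcongr
      _ = _ := by ring
  have hint : ∀ k : ℕ, Integrable (fun x => ‖w x‖ ^ k) (haarAddCircle (T := P)) := fun k =>
    Integrable.of_bound (hwm.norm.pow k).aestronglyMeasurable ((A * B) ^ k)
      (Eventually.of_forall fun x => by
        rw [norm_pow, norm_norm]
        exact pow_le_pow_left₀ (norm_nonneg _) (hwb x) k)
  have h1 : ∫ x, ‖w x‖ ∂(haarAddCircle (T := P)) ≤ A * S := by
    refine le_of_sq_le_sq ?_ (by positivity)
    refine le_trans ?_ h2
    refine ConvexOn.map_integral_le (μ := haarAddCircle (T := P)) (s := univ)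
      (f := fun x => ‖w x‖) (g := fun y : ℝ => y ^ 2) (even_two.convexOn_pow)
      (by fun_prop) isClosed_univ (by simp) ?_ (hint 2)
    simpa using hint 1
  have hi1 : Integrable (fun x => A * ‖w x‖) (haarAddCircle (T := P)) := by
    simpa using (hint 1).const_mul A
  calc _ ≤ ∫ x, A * ‖w x‖ ∂(haarAddCircle (T := P)) :=
        norm_integral_le_of_norm_le hi1 (Eventually.of_forall fun x => by
          rw [norm_mul]
          exact mul_le_mul_of_nonneg_right (hu x) (norm_nonneg _))
    _ ≤ A * (A * S) := by
        rw [integral_const_mul]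
        gcongr
    _ = _ := by ring

theorem integral_haarAddCircle_eq_Ico (f : AddCircle P → ℂ) :
    ∫ x, f x ∂haarAddCircle = (P⁻¹ : ℂ) * ∫ x in Ico 0 P, f (x : AddCircle P) := by
  rw [integral_haarAddCircle, ← AddCircle.integral_preimage P 0, zero_add,
    integral_Ioc_eq_integral_Ioo, ← integral_Ico_eq_integral_Ioo, Complex.real_smul]
  push_cast
  rfl

theorem stronglyMeasurable_liftIco {f : ℝ → ℂ} (hf : Measurable f) :
    StronglyMeasurable (liftIco P 0 f) := by
  refine Measurable.stronglyMeasurable ?_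
  exact hf.comp (measurable_subtype_coe.comp (measurableEquivIco P 0).measurable)

end Circle

open MeasureTheory AddCircle in
-- For `x` in `[T, 2T)` and `z` in `[0, T)` the difference `x - z` stays in `(0, 2T)`. Hence the
-- double integral is a genuine convolution pairing on the circle of length `2T`, with no
-- wrap-around. The two normalizations of Haar measure account for `(2 * T) ^ 2`.
theorem norm_integral_integral_le_of_norm_integral_exp_le {T : ℝ} (hT : 0 < T) {h K : ℝ → ℂ}
    (hh : Measurable h) (hK : Measurable K) {A B S : ℝ} (hA : ∀ x, ‖K x‖ ≤ A)
    (hB : ∀ x, ‖h x‖ ≤ B)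
    (hS : ∀ μ : ℝ, ‖∫ t in (0 : ℝ)..2 * T, h t * expi (-μ) t‖ ≤ S * (2 * T)) :
    ‖∫ x in Ico T (2 * T), ∫ z in Ico 0 T, K x * K z * h (x - z)‖ ≤ A ^ 2 * S * (2 * T) ^ 2 := by
  have : Fact (0 < 2 * T) := ⟨by positivity⟩
  have hA0 : 0 ≤ A := (norm_nonneg _).trans (hA 0)
  have hTc : ((2 * T : ℝ) : ℂ) ≠ 0 := by exact_mod_cast (by positivity : 2 * T ≠ 0)
  set u := liftIco (2 * T) 0 ((Ico T (2 * T)).indicator K)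
  set v := liftIco (2 * T) 0 ((Ico 0 T).indicator K)
  set g := liftIco (2 * T) 0 h
  have hind : ∀ s x, ‖(s : Set ℝ).indicator K x‖ ≤ A := fun s x =>
    (norm_indicator_le_norm_self _ _).trans (hA x)
  have hmain := norm_integral_mul_conv_le (P := 2 * T) (u := u) (v := v) (g := g) (A := A)
    (B := B) (S := S)
    (stronglyMeasurable_liftIco (hK.indicator measurableSet_Ico))
    (stronglyMeasurable_liftIco hh) (fun x => hind _ _) (fun x => hind _ _) (fun x => hB _) ?_
  · have e1 : ∀ x ∈ Ico T (2 * T), ∫ z, v z * g ((x : AddCircle (2 * T)) - z) ∂haarAddCircle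
        = ((2 * T : ℝ) : ℂ)⁻¹ * ∫ z in Ico 0 T, K z * h (x - z) := by
      intro x hx
      rw [integral_haarAddCircle_eq_Ico]
      congr 1
      have : ∀ z ∈ Ico 0 (2 * T), v z * g ((x : AddCircle (2 * T)) - z)
          = (Ico 0 T).indicator (fun z => K z * h (x - z)) z := by
        intro z hz
        simp only [v]
        rw [liftIco_zero_coe_apply hz]
        by_cases hz' : z ∈ Ico 0 T
        · rw [indicator_of_mem hz', indicator_of_mem hz', ← AddCircle.coe_sub]
          simp only [g]
          rw [liftIco_zero_coe_apply ⟨by linarith [hx.1, hz'.2], by linarith [hx.2, hz'.1]⟩]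
        · rw [indicator_of_notMem hz', indicator_of_notMem hz', zero_mul]
      rw [setIntegral_congr_fun measurableSet_Ico this, setIntegral_indicator measurableSet_Ico,
        inter_eq_self_of_subset_right (Ico_subset_Ico_right (by linarith))]
    have e2 : ∫ x, u x * ∫ z, v z * g (x - z) ∂haarAddCircle ∂haarAddCircle
        = (((2 * T : ℝ) : ℂ)⁻¹) ^ 2
          * ∫ x in Ico T (2 * T), ∫ z in Ico 0 T, K x * K z * h (x - z) := by
      rw [integral_haarAddCircle_eq_Ico, sq, mul_assoc]
      congr 1
      have : ∀ x ∈ Ico 0 (2 * T), u x * ∫ z, v z * g ((x : AddCircle (2 * T)) - z) ∂haarAddCircle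
          = (Ico T (2 * T)).indicator (fun x => ((2 * T : ℝ) : ℂ)⁻¹ *
            ∫ z in Ico 0 T, K x * K z * h (x - z)) x := by
        intro x hx
        simp only [u]
        rw [liftIco_zero_coe_apply hx]
        by_cases hx' : x ∈ Ico T (2 * T)
        · rw [indicator_of_mem hx', indicator_of_mem hx', e1 x hx', mul_left_comm,
            ← integral_const_mul]
          simp only [mul_assoc]
        · rw [indicator_of_notMem hx', indicator_of_notMem hx', zero_mul]
      rw [setIntegral_congr_fun measurableSet_Ico this, setIntegral_indicator measurableSet_Ico,
        inter_eq_self_of_subset_right (Ico_subset_Ico_left hT.le), integral_const_mul]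
    rw [e2, norm_mul, norm_pow, norm_inv, Complex.norm_real, Real.norm_eq_abs,
      abs_of_pos (by positivity), inv_pow, inv_mul_le_iff₀ (by positivity)] at hmain
    linarith
  · intro n
    rw [fourierCoeff, integral_haarAddCircle_eq_Ico]
    have : ∀ x ∈ Ico 0 (2 * T), fourier (-n) (x : AddCircle (2 * T)) • g x
        = h x * expi (-(2 * Real.pi * n / (2 * T))) x := by
      intro x hx
      simp only [g]
      rw [liftIco_zero_coe_apply hx, smul_eq_mul, mul_comm, fourier_coe_apply, expi_apply]
      congr 2
      push_cast
      ring
    rw [setIntegral_congr_fun measurableSet_Ico this, integral_Ico_eq_integral_Ioo,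
      ← integral_Ioc_eq_integral_Ioo, ← intervalIntegral.integral_of_le (by positivity), norm_mul,
      norm_inv, Complex.norm_real, Real.norm_eq_abs, abs_of_pos (by positivity),
      inv_mul_le_iff₀ (by positivity)]
    linarith [hS (2 * Real.pi * n / (2 * T))]

/-! ### Uniform smallness of Fourier integrals over long windows -/

theorem norm_integral_mul_expi_eq (g : ℝ →ᵇ ℂ) (μ a T : ℝ) :
    ‖∫ t in a..a + T, g t * expi μ t‖ = ‖∫ t in (0 : ℝ)..T, translate a g t * expi μ t‖ := by
  have h := intervalIntegral.integral_comp_add_right (a := 0) (b := T)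
    (fun t => g t * expi μ t) a
  rw [zero_add, add_comm T a] at h
  rw [← h]
  have : ∀ t, g (t + a) * expi μ (t + a) = expi μ a * (translate a g t * expi μ t) := by
    intro t
    rw [expi_add_apply, translate_apply]
    ring
  simp only [this]
  rw [intervalIntegral.integral_const_mul, norm_mul, norm_expi_apply, one_mul]

theorem tendsto_integral_mul_expi (y : ℝ →ᵇ ℂ) :
    Tendsto (fun μ : ℝ => ∫ t in (0 : ℝ)..1, y t * expi (-μ) t) (cocompact ℝ) (𝓝 0) := by
  have h := Real.tendsto_integral_exp_smul_cocompact (indicator (Ioc 0 1) y)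
  have h2 : Tendsto (fun μ : ℝ => μ * (2 * Real.pi)⁻¹) (cocompact ℝ) (cocompact ℝ) :=
    (Homeomorph.mulRight₀ ((2 * Real.pi)⁻¹) (by positivity)).isClosedEmbedding.tendsto_cocompact
  refine (h.comp h2).congr fun μ => ?_
  rw [intervalIntegral.integral_of_le zero_le_one, ← MeasureTheory.integral_indicator
    measurableSet_Ioc]
  simp only [Function.comp]
  congr 1
  ext t
  by_cases ht : t ∈ Ioc (0 : ℝ) 1
  · rw [indicator_of_mem ht, indicator_of_mem ht, Circle.smul_def, smul_eq_mul, mul_comm,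
      Real.fourierChar_apply, expi_apply]
    congr 2
    push_cast
    have : (Real.pi : ℂ) ≠ 0 := by exact_mod_cast Real.pi_ne_zero
    field_simp
  · rw [indicator_of_notMem ht, indicator_of_notMem ht, smul_zero]

theorem norm_integral_sub_mul_expi_le {y z : ℝ →ᵇ ℂ} {ε : ℝ} (h : ‖y - z‖ ≤ ε) (μ : ℝ) {T : ℝ}
    (hT : 0 ≤ T) : ‖∫ t in (0 : ℝ)..T, y t * expi μ t‖
      ≤ ‖∫ t in (0 : ℝ)..T, z t * expi μ t‖ + ε * T := by
  have h1 : ‖∫ t in (0 : ℝ)..T, (y t - z t) * expi μ t‖ ≤ ε * |T - 0| := by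
    refine intervalIntegral.norm_integral_le_of_norm_le_const fun t _ => ?_
    rw [norm_mul, norm_expi_apply, mul_one]
    exact ((y - z).norm_coe_le_norm t).trans h
  rw [sub_zero, abs_of_nonneg hT] at h1
  have h2 : ∫ t in (0 : ℝ)..T, (y t - z t) * expi μ t
      = (∫ t in (0 : ℝ)..T, y t * expi μ t) - ∫ t in (0 : ℝ)..T, z t * expi μ t := by
    rw [← intervalIntegral.integral_sub ((by fun_prop : Continuous _).intervalIntegrable _ _)
      ((by fun_prop : Continuous _).intervalIntegrable _ _)]
    simp only [sub_mul]
  rw [h2] at h1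
  linarith [norm_sub_norm_le (∫ t in (0 : ℝ)..T, y t * expi μ t)
    (∫ t in (0 : ℝ)..T, z t * expi μ t)]

/-- The Riemann–Lebesgue lemma for each member of a finite net of the orbit gives a bound uniform in
the position of the window. -/
theorem IsAP.eventually_cocompact_norm_integral_le {g : ℝ →ᵇ ℂ} (hg : IsAP g) {η : ℝ}
    (hη : 0 < η) : ∀ᶠ μ in cocompact ℝ, ∀ a, ‖∫ t in a..a + 1, g t * expi (-μ) t‖ ≤ η * 1 := by
  obtain ⟨K, hK, hgK⟩ := hg
  obtain ⟨F, hF, hcov⟩ := Metric.totallyBounded_iff.1 hK.totallyBounded (η / 2) (by positivity)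
  have hev : ∀ᶠ μ in cocompact ℝ, ∀ y ∈ F, ‖∫ t in (0 : ℝ)..1, y t * expi (-μ) t‖ < η / 2 := by
    rw [Filter.eventually_all_finite hF]
    intro y _
    have := (tendsto_integral_mul_expi y).norm
    rw [norm_zero] at this
    exact this.eventually_lt_const (half_pos hη)
  filter_upwards [hev] with μ hμ a
  obtain ⟨y, hy, hd⟩ := mem_iUnion₂.1 (hcov (hgK a))
  rw [norm_integral_mul_expi_eq]
  rw [Metric.mem_ball, dist_eq_norm] at hd
  linarith [norm_integral_sub_mul_expi_le hd.le (-μ) zero_le_one, hμ y hy]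

/-- On a window of fixed length, moved to `[0, T]`, the exponentials with frequencies `-μ` and `-μ₀`
differ by at most `|μ - μ₀| * T`. -/
theorem eventually_nhds_norm_integral_le (g : ℝ →ᵇ ℂ) {μ₀ : ℝ}
    (h : HasMean (fun t => g t * expi (-μ₀) t) 0) {η : ℝ} (hη : 0 < η) :
    ∃ T : ℝ, 0 < T ∧ ∀ᶠ μ in 𝓝 μ₀, ∀ a, ‖∫ t in a..a + T, g t * expi (-μ) t‖ ≤ η * T := by
  obtain ⟨T, hT, h⟩ := h (η / 2) (by positivity)
  refine ⟨T, hT, ?_⟩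
  have hδ : 0 < η / (2 * T * (‖g‖ + 1)) := by positivity
  filter_upwards [Metric.ball_mem_nhds μ₀ hδ] with μ hμ a
  rw [Metric.mem_ball, Real.dist_eq] at hμ
  have h0 := h T le_rfl a
  rw [mul_zero, sub_zero, norm_integral_mul_expi_eq] at h0
  rw [norm_integral_mul_expi_eq]
  have h1 : ‖∫ t in (0 : ℝ)..T, translate a g t * (expi (-μ) t - expi (-μ₀) t)‖
      ≤ η / 2 * |T - 0| := by
    refine intervalIntegral.norm_integral_le_of_norm_le_const fun t ht => ?_
    rw [uIoc_of_le hT.le] at ht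
    have e1 : expi (-μ) t - expi (-μ₀) t
        = expi (-μ₀) t * (Complex.exp (Complex.I * ((μ₀ - μ) * t : ℝ)) - 1) := by
      simp only [expi_apply, mul_sub, ← Complex.exp_add, mul_one]
      congr 2
      push_cast
      ring
    have e2 : ‖expi (-μ) t - expi (-μ₀) t‖ ≤ |μ - μ₀| * T := by
      rw [e1, norm_mul, norm_expi_apply, one_mul]
      refine Real.norm_exp_I_mul_ofReal_sub_one_le.trans ?_
      rw [norm_mul, Real.norm_eq_abs, Real.norm_eq_abs, abs_sub_comm, abs_of_pos ht.1]
      exact mul_le_mul_of_nonneg_left ht.2 (abs_nonneg _)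
    rw [norm_mul]
    calc _ ≤ ‖g‖ * (|μ - μ₀| * T) := by
          gcongr
          exact g.norm_coe_le_norm _
      _ ≤ (‖g‖ + 1) * (η / (2 * T * (‖g‖ + 1)) * T) := by
          gcongr
          linarith
      _ = η / 2 := by field_simp
  rw [sub_zero, abs_of_pos hT] at h1
  have h2 : ∫ t in (0 : ℝ)..T, translate a g t * (expi (-μ) t - expi (-μ₀) t)
      = (∫ t in (0 : ℝ)..T, translate a g t * expi (-μ) t)
        - ∫ t in (0 : ℝ)..T, translate a g t * expi (-μ₀) t := by
    rw [← intervalIntegral.integral_sub ((by fun_prop : Continuous _).intervalIntegrable _ _)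
      ((by fun_prop : Continuous _).intervalIntegrable _ _)]
    simp only [mul_sub]
  rw [h2] at h1
  linarith [norm_sub_norm_le (∫ t in (0 : ℝ)..T, translate a g t * expi (-μ) t)
    (∫ t in (0 : ℝ)..T, translate a g t * expi (-μ₀) t)]

theorem exists_forall_norm_integral_le_of_block (g : ℝ →ᵇ ℂ) {η T : ℝ} (hη : 0 < η) (hT : 0 < T)
    {s : Set ℝ} (h : ∀ μ ∈ s, ∀ a, ‖∫ t in a..a + T, g t * expi (-μ) t‖ ≤ η / 2 * T) :
    ∃ T₀ : ℝ, 0 < T₀ ∧ ∀ S, T₀ ≤ S → ∀ μ ∈ s, ∀ a,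
      ‖∫ t in a..a + S, g t * expi (-μ) t‖ ≤ η * S := by
  refine ⟨2 * T * (‖g‖ + 1) / η, by positivity, fun S hS μ hμ a => ?_⟩
  have hS0 : 0 < S := lt_of_lt_of_le (by positivity) hS
  have := norm_integral_le_of_norm_integral_block_le (h := fun t => g t * expi (-μ) t)
    (by fun_prop) (B := ‖g‖) (fun t => by
      rw [norm_mul, norm_expi_apply, mul_one]; exact g.norm_coe_le_norm t)
    hT (half_pos hη).le (h μ hμ) hS0.le a
  rw [div_le_iff₀ hη] at hS
  nlinarith

/-- Uniformity in `μ`: frequencies outside a compact set are handled by Riemann–Lebesgue on unit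
blocks, those inside by finitely many neighbourhoods, each with its own block length. -/
theorem IsAP.uniform_norm_integral_le {g : ℝ →ᵇ ℂ} (hg : IsAP g)
    (h : ∀ μ, HasMean (fun t => g t * expi (-μ) t) 0) {η : ℝ} (hη : 0 < η) :
    ∃ T₀ : ℝ, 0 < T₀ ∧ ∀ T, T₀ ≤ T → ∀ μ a, ‖∫ t in a..a + T, g t * expi (-μ) t‖ ≤ η * T := by
  obtain ⟨C, hC, hout⟩ := (Filter.hasBasis_cocompact.eventually_iff).1
    (hg.eventually_cocompact_norm_integral_le (half_pos hη))
  obtain ⟨T₁, hT₁, h1⟩ := exists_forall_norm_integral_le_of_block g hη one_pos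
    (s := Cᶜ) (fun μ hμ => hout hμ)
  obtain ⟨T₂, hT₂, h2⟩ : ∃ T₀ : ℝ, 0 < T₀ ∧ ∀ S, T₀ ≤ S → ∀ μ ∈ C, ∀ a,
      ‖∫ t in a..a + S, g t * expi (-μ) t‖ ≤ η * S := by
    refine hC.induction_on (p := fun s => ∃ T₀ : ℝ, 0 < T₀ ∧ ∀ S, T₀ ≤ S → ∀ μ ∈ s, ∀ a,
      ‖∫ t in a..a + S, g t * expi (-μ) t‖ ≤ η * S) ⟨1, one_pos, by simp⟩ ?_ ?_ ?_
    · rintro s t hst ⟨T₀, hT₀, h⟩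
      exact ⟨T₀, hT₀, fun S hS μ hμ => h S hS μ (hst hμ)⟩
    · rintro s t ⟨T₀, hT₀, h⟩ ⟨T₁, hT₁, h'⟩
      refine ⟨max T₀ T₁, by positivity, fun S hS μ hμ a => hμ.elim (fun hμ => ?_) fun hμ => ?_⟩
      · exact h S ((le_max_left _ _).trans hS) μ hμ a
      · exact h' S ((le_max_right _ _).trans hS) μ hμ a
    · intro μ₀ _
      obtain ⟨T, hT, hev⟩ := eventually_nhds_norm_integral_le g (h μ₀) (half_pos hη)
      exact ⟨_, mem_nhdsWithin_of_mem_nhds hev,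
        exists_forall_norm_integral_le_of_block g hη hT fun μ hμ => hμ⟩
  refine ⟨max T₁ T₂, by positivity, fun T hT μ a => ?_⟩
  by_cases hμ : μ ∈ C
  · exact h2 T ((le_max_right _ _).trans hT) μ hμ a
  · exact h1 T ((le_max_left _ _).trans hT) μ hμ a

/-! ### The uniqueness theorem -/

/-- A nonnegative weight that is positive only at the `ε`-almost periods of `h`. -/
def periodWeight (h : ℝ →ᵇ ℂ) (ε τ : ℝ) : ℝ := max 0 (ε - ‖translate τ h - h‖)

theorem periodWeight_nonneg (h : ℝ →ᵇ ℂ) (ε τ : ℝ) : 0 ≤ periodWeight h ε τ := le_max_left _ _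

theorem periodWeight_le (h : ℝ →ᵇ ℂ) {ε : ℝ} (hε : 0 ≤ ε) (τ : ℝ) : periodWeight h ε τ ≤ ε :=
  max_le hε (by linarith [norm_nonneg (translate τ h - h)])

theorem translate_zero (h : ℝ →ᵇ ℂ) : translate 0 h = h := by
  ext x
  simp

theorem IsAP.continuous_periodWeight {h : ℝ →ᵇ ℂ} (hh : IsAP h) (ε : ℝ) :
    Continuous (periodWeight h ε) := by
  have := continuous_translate hh.uniformContinuous
  unfold periodWeight
  fun_prop

/-- Every window of length `2 * L` contains an `ε / 4`-almost period, and by uniform continuity the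
weight is at least `ε / 2` on the interval of length `δ` to its right. -/
theorem IsAP.exists_le_integral_periodWeight {h : ℝ →ᵇ ℂ} (hh : IsAP h) {ε : ℝ} (hε : 0 < ε) :
    ∃ l : ℝ, 0 < l ∧ ∃ c : ℝ, 0 < c ∧ ∀ a, c ≤ ∫ t in a..a + l, periodWeight h ε t := by
  have hc := hh.continuous_periodWeight ε
  obtain ⟨L, hL, hnet⟩ := hh.exists_bounded_net (ε := ε / 4) (by positivity)
  have htc := continuous_translate hh.uniformContinuous
  obtain ⟨δ, hδ, hδ'⟩ := Metric.continuous_iff.1 htc 0 (ε / 4) (by positivity)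
  have hδ2 : ∀ s, |s| < δ → ‖translate s h - h‖ < ε / 4 := by
    intro s hs
    have := hδ' s (by simpa using hs)
    rwa [translate_zero, dist_eq_norm] at this
  refine ⟨2 * L + δ, by positivity, ε / 2 * δ, by positivity, fun a => ?_⟩
  obtain ⟨r, hr, hτ⟩ := hnet (a + L)
  have hr' := abs_le.1 hr
  set τ := a + L - r with hτ_def
  have hτ' : ‖translate τ h - h‖ ≤ ε / 4 := by
    have := norm_translate_sub_translate_le (-r) (a + L) r h
    rw [neg_add_cancel, translate_zero, neg_add_eq_sub] at this
    exact this.trans hτ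
  have hlow : ∀ t ∈ Ioo τ (τ + δ), ε / 2 ≤ periodWeight h ε t := by
    intro t ht
    have h1 : ‖translate t h - translate τ h‖ < ε / 4 := by
      have := norm_translate_sub_translate_le τ (t - τ) 0 h
      rw [add_sub_cancel, add_zero, translate_zero] at this
      exact this.trans_lt (hδ2 _ (by rw [abs_of_pos] <;> linarith [ht.1, ht.2]))
    have h2 := norm_add_le (translate t h - translate τ h) (translate τ h - h)
    rw [sub_add_sub_cancel] at h2
    exact le_max_of_le_right (by linarith)
  have h1 : ε / 2 * δ ≤ ∫ t in τ..τ + δ, periodWeight h ε t := by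
    have : ε / 2 * δ = ∫ t in τ..τ + δ, ε / 2 := by simp; ring
    rw [this]
    exact intervalIntegral.integral_mono_on_of_le_Ioo (by linarith)
      (continuous_const.intervalIntegrable _ _) (hc.intervalIntegrable _ _) hlow
  refine h1.trans ?_
  exact intervalIntegral.integral_mono_interval (by linarith) (by linarith) (by linarith)
    (Eventually.of_forall fun t => periodWeight_nonneg h ε t) (hc.intervalIntegrable _ _)

theorem le_integral_mul_nat {k : ℝ → ℝ} (hk : Continuous k) {l c : ℝ}
    (h : ∀ a, c ≤ ∫ t in a..a + l, k t) (n : ℕ) (a : ℝ) :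
    n * c ≤ ∫ t in a..a + n * l, k t := by
  induction n with
  | zero => simp
  | succ n ih =>
    rw [← intervalIntegral.integral_add_adjacent_intervals (b := a + n * l)
      (hk.intervalIntegrable _ _) (hk.intervalIntegrable _ _)]
    have := h (a + n * l)
    rw [show a + n * l + l = a + ((n + 1 : ℕ) : ℝ) * l by push_cast; ring] at this
    push_cast at this ⊢
    linarith

/-- The difference of two `ε`-almost periods is a `2ε`-almost period. The factor of weights makes
the claim trivial wherever `x` or `z` is not an almost period. -/
theorem norm_apply_sub_mul_periodWeight_le (h : ℝ →ᵇ ℂ) (ε x z : ℝ) :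
    ‖h (x - z) - h 0‖ * (periodWeight h ε x * periodWeight h ε z)
      ≤ 2 * ε * (periodWeight h ε x * periodWeight h ε z) := by
  rcases (periodWeight_nonneg h ε x).eq_or_lt with hx | hx
  · simp [← hx]
  rcases (periodWeight_nonneg h ε z).eq_or_lt with hz | hz
  · simp [← hz]
  refine mul_le_mul_of_nonneg_right ?_ (by positivity)
  have hx' : ‖translate x h - h‖ < ε := by
    have := (lt_max_iff.1 hx).resolve_left (lt_irrefl _)
    linarith
  have hz' : ‖translate z h - h‖ < ε := by
    have := (lt_max_iff.1 hz).resolve_left (lt_irrefl _)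
    linarith
  have h1 := (translate x h - h).norm_coe_le_norm (-z)
  have h2 := (translate z h - h).norm_coe_le_norm (-z)
  simp only [BoundedContinuousFunction.coe_sub, Pi.sub_apply, translate_apply,
    neg_add_cancel, neg_add_eq_sub] at h1 h2
  calc ‖h (x - z) - h 0‖ = ‖(h (x - z) - h (-z)) - (h 0 - h (-z))‖ := by congr 1; ring
    _ ≤ _ := (norm_sub_le _ _).trans (by linarith)

open MeasureTheory in
-- Suppose `h 0 ≠ 0` for a translate `h` of `g`, and integrate `k x * k z * h (x - z)` with `k`
-- concentrated on almost periods. There `h (x - z)` is close to `h 0`, so the integral is large;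
-- the convolution estimate makes it small, since all Fourier integrals of `h` over long windows are
-- small.
theorem IsAP.eq_zero_of_hasMean_zero {g : ℝ →ᵇ ℂ} (hg : IsAP g)
    (h0 : ∀ μ, HasMean (fun t => g t * expi (-μ) t) 0) : g = 0 := by
  ext x₀
  by_contra hx₀
  simp only [BoundedContinuousFunction.coe_zero, Pi.zero_apply] at hx₀
  set h := translate x₀ g with hh_def
  have hh : IsAP h := hg.comp_translate x₀
  have hh0 : h 0 = g x₀ := by simp [hh_def]
  set ε := ‖h 0‖ / 4 with hε_def
  have hε : 0 < ε := by rw [hε_def, hh0]; positivity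
  set k := periodWeight h ε with hk_def
  have hkc : Continuous k := hh.continuous_periodWeight ε
  have hk0 : ∀ t, 0 ≤ k t := periodWeight_nonneg h ε
  have hkε : ∀ t, k t ≤ ε := periodWeight_le h hε.le
  obtain ⟨l, hl, c, hc, hlc⟩ := hh.exists_le_integral_periodWeight hε
  -- Chosen so that for `T = n * l` the upper bound `ε ^ 2 * η * (2 * T) ^ 2` equals `ε * (n * c) ^
  -- 2`, which is at most `ε * I`.
  set η := c ^ 2 / (4 * ε * l ^ 2) with hη_def
  have hη : 0 < η := by positivity
  obtain ⟨T₀, hT₀, hsmall⟩ := hg.uniform_norm_integral_le h0 hη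
  obtain ⟨n, hn⟩ := exists_nat_gt (T₀ / l)
  have hn0 : (0 : ℝ) < n := lt_trans (by positivity) hn
  set T := n * l with hT_def
  have hT : 0 < T := by positivity
  rw [div_lt_iff₀ hl] at hn
  have hS : ∀ μ : ℝ, ‖∫ t in (0 : ℝ)..2 * T, h t * expi (-μ) t‖ ≤ η * (2 * T) := by
    intro μ
    rw [← norm_integral_mul_expi_eq]
    exact hsmall (2 * T) (by linarith) μ x₀
  have hup := norm_integral_integral_le_of_norm_integral_exp_le hT (h := h)
    (K := fun t => (k t : ℂ)) h.continuous.measurable (by fun_prop) (A := ε) (B := ‖h‖)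
    (fun t => by rw [Complex.norm_real, Real.norm_eq_abs, abs_of_nonneg (hk0 t)]; exact hkε t)
    h.norm_coe_le_norm hS
  -- the iterated integral is an integral over a product
  set ρ : Measure (ℝ × ℝ) :=
    (volume.restrict (Ico T (2 * T))).prod (volume.restrict (Ico 0 T)) with hρ
  have hbd : ∀ φ : ℝ × ℝ → ℂ, Continuous φ → (∃ C, ∀ p, ‖φ p‖ ≤ C) → Integrable φ ρ := by
    rintro φ hφ ⟨C, hC⟩
    exact Integrable.of_bound hφ.aestronglyMeasurable C (Eventually.of_forall hC)
  have hkk : ∀ p : ℝ × ℝ, ‖((k p.1 * k p.2 : ℝ) : ℂ)‖ ≤ ε * ε := by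
    intro p
    rw [Complex.norm_real, Real.norm_eq_abs, abs_of_nonneg (mul_nonneg (hk0 _) (hk0 _))]
    exact mul_le_mul (hkε _) (hkε _) (hk0 _) hε.le
  have hi1 : Integrable (fun p : ℝ × ℝ => ((k p.1 * k p.2 : ℝ) : ℂ)) ρ :=
    hbd _ (by fun_prop) ⟨_, hkk⟩
  have hi2 : Integrable (fun p : ℝ × ℝ => ((k p.1 * k p.2 : ℝ) : ℂ) * h (p.1 - p.2)) ρ :=
    hbd _ (by fun_prop) ⟨ε * ε * ‖h‖, fun p => by
      rw [norm_mul]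
      exact mul_le_mul (hkk p) (h.norm_coe_le_norm _) (norm_nonneg _) (by positivity)⟩
  have e1 : ∫ x in Ico T (2 * T), ∫ z in Ico 0 T, (k x : ℂ) * k z * h (x - z)
      = ∫ p, ((k p.1 * k p.2 : ℝ) : ℂ) * h (p.1 - p.2) ∂ρ := by
    rw [hρ, integral_prod _ hi2]
    push_cast
    rfl
  set I := ∫ p, k p.1 * k p.2 ∂ρ with hI
  have hlow : ∀ a, n * c ≤ ∫ t in Ico a (a + T), k t := by
    intro a
    have := le_integral_mul_nat hkc hlc n a
    rwa [intervalIntegral.integral_of_le (by linarith), integral_Ioc_eq_integral_Ioo,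
      ← integral_Ico_eq_integral_Ioo] at this
  have hI1 : (n * c) ^ 2 ≤ I := by
    rw [hI, hρ, integral_prod_mul (f := k) (g := k), sq]
    have h1 := hlow T
    have h2 := hlow 0
    rw [← two_mul] at h1
    rw [zero_add] at h2
    exact mul_le_mul h1 h2 (by positivity) ((by positivity : 0 ≤ n * c).trans h1)
  have e2 : ‖(∫ p, ((k p.1 * k p.2 : ℝ) : ℂ) * h (p.1 - p.2) ∂ρ) - (I : ℂ) * h 0‖
      ≤ 2 * ε * I := by
    have : (I : ℂ) * h 0 = ∫ p, ((k p.1 * k p.2 : ℝ) : ℂ) * h 0 ∂ρ := by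
      rw [integral_mul_const, hI, integral_complex_ofReal]
    rw [this, ← integral_sub hi2 (hi1.mul_const _), hI, ← integral_const_mul]
    refine norm_integral_le_of_norm_le ?_ (Eventually.of_forall fun p => ?_)
    · have := (hi1.re.const_mul (2 * ε))
      simpa using this
    · rw [← mul_sub, norm_mul, Complex.norm_real, Real.norm_eq_abs,
        abs_of_nonneg (mul_nonneg (hk0 _) (hk0 _)), mul_comm]
      exact norm_apply_sub_mul_periodWeight_le h ε p.1 p.2
  rw [e1] at hup
  have hI0 : 0 < I := lt_of_lt_of_le (by positivity) hI1
  have e3 : ‖(I : ℂ) * h 0‖ = 4 * ε * I := by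
    rw [norm_mul, Complex.norm_real, Real.norm_eq_abs, abs_of_pos hI0, hε_def]
    ring
  have e4 := norm_sub_norm_le ((I : ℂ) * h 0)
    (∫ p, ((k p.1 * k p.2 : ℝ) : ℂ) * h (p.1 - p.2) ∂ρ)
  rw [norm_sub_rev, e3] at e4
  have e5 : ε ^ 2 * η * (2 * T) ^ 2 = ε * (n * c) ^ 2 := by
    rw [hη_def, hT_def]
    field_simp
    ring
  -- The main term has norm `4 * ε * I` and the error is at most `2 * ε * I`, so the integral has
  -- norm at least `2 * ε * I`, against the upper bound `ε * I`.
  have : 2 * ε * I ≤ ε * I := by nlinarith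
  nlinarith

theorem HasMean.of_approx {g : ℝ → ℂ} {m : ℂ} (hg : Continuous g)
    (h : ∀ ε : ℝ, 0 < ε → ∃ (k : ℝ → ℂ) (n : ℂ), Continuous k ∧ HasMean k n ∧
      (∀ t, ‖g t - k t‖ ≤ ε) ∧ ‖m - n‖ ≤ ε) : HasMean g m := by
  intro ε hε
  obtain ⟨k, n, hk, hn, hgk, hmn⟩ := h (ε / 3) (by positivity)
  obtain ⟨T₀, hT₀, h⟩ := hn (ε / 3) (by positivity)
  refine ⟨T₀, hT₀, fun T hT a => ?_⟩
  have hT0 : 0 < T := hT₀.trans_le hT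
  have h1 : ‖∫ t in a..a + T, (g t - k t)‖ ≤ ε / 3 * |a + T - a| :=
    intervalIntegral.norm_integral_le_of_norm_le_const fun t _ => hgk t
  rw [add_sub_cancel_left, abs_of_pos hT0, intervalIntegral.integral_sub
    (hg.intervalIntegrable _ _) (hk.intervalIntegrable _ _)] at h1
  have h2 : ‖(T : ℂ) * (m - n)‖ ≤ ε / 3 * T := by
    rw [norm_mul, Complex.norm_real, Real.norm_eq_abs, abs_of_pos hT0, mul_comm]
    gcongr
  have e : (∫ t in a..a + T, g t) - T * m = ((∫ t in a..a + T, g t) - ∫ t in a..a + T, k t)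
      + ((∫ t in a..a + T, k t) - T * n) - T * (m - n) := by ring
  rw [e]
  linarith [norm_sub_le (((∫ t in a..a + T, g t) - ∫ t in a..a + T, k t)
      + ((∫ t in a..a + T, k t) - T * n)) (T * (m - n)),
    norm_add_le ((∫ t in a..a + T, g t) - ∫ t in a..a + T, k t)
      ((∫ t in a..a + T, k t) - T * n), h T hT a]

/-! ### Equidistribution on the torus and Kronecker's theorem -/

section Torus

open MeasureTheory UnitAddTorus

variable {ι : Type*}

/-- The linear flow on the torus with the given frequencies. -/
def torusFlow (μ : ι → ℝ) (t : ℝ) : UnitAddTorus ι :=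
  fun i => ((μ i * t / (2 * Real.pi) : ℝ) : AddCircle (1 : ℝ))

theorem continuous_torusFlow (μ : ι → ℝ) : Continuous (torusFlow μ) :=
  continuous_pi fun i => (AddCircle.continuous_mk' 1).comp (by fun_prop)

theorem fourier_coe_div (m : ℤ) (x : ℝ) :
    fourier m ((x / (2 * Real.pi) : ℝ) : AddCircle (1 : ℝ)) = Complex.exp (m * x * Complex.I) := by
  have : (Real.pi : ℂ) ≠ 0 := by exact_mod_cast Real.pi_ne_zero
  rw [fourier_coe_apply]
  congr 1
  push_cast
  field_simp

variable [Fintype ι]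

theorem mFourier_torusFlow (μ : ι → ℝ) (n : ι → ℤ) (t : ℝ) :
    mFourier n (torusFlow μ t) = expi (∑ i, n i * μ i) t := by
  simp only [mFourier, ContinuousMap.coe_mk, torusFlow, fourier_coe_div, expi_apply]
  rw [← Complex.exp_sum]
  congr 1
  push_cast
  rw [Finset.sum_mul, Finset.sum_mul]
  exact Finset.sum_congr rfl fun i _ => by ring

theorem volume_real_univ_unitAddTorus :
    (volume : Measure (UnitAddTorus ι)).real univ = 1 := by
  simp [measureReal_def, volume_pi, Measure.pi_univ, AddCircle.measure_univ]

theorem integral_fourier_of_ne_zero {m : ℤ} (hm : m ≠ 0) :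
    ∫ x : AddCircle (1 : ℝ), fourier m x = 0 := by
  have h := congrFun (fourierCoeff_fourier (T := 1) m) 0
  rw [Pi.single_eq_of_ne hm.symm, fourierCoeff, AddCircle.integral_haarAddCircle] at h
  simpa using h

theorem integral_mFourier_of_ne_zero {n : ι → ℤ} (hn : n ≠ 0) :
    ∫ x : UnitAddTorus ι, mFourier n x = 0 := by
  obtain ⟨i, hi⟩ := Function.ne_iff.1 hn
  simp only [mFourier, ContinuousMap.coe_mk]
  rw [MeasureTheory.integral_fintype_prod_volume_eq_prod (fun i => fun x => fourier (n i) x)]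
  exact Finset.prod_eq_zero (Finset.mem_univ i) (integral_fourier_of_ne_zero hi)

/-- Weyl's argument: along the flow a nontrivial character becomes an exponential with nonzero
frequency, whose mean is zero like its integral; trigonometric polynomials are dense. -/
theorem hasMean_torusFlow {μ : ι → ℝ} (hμ : ∀ n : ι → ℤ, ∑ i, (n i : ℝ) * μ i = 0 → n = 0)
    (φ : C(UnitAddTorus ι, ℂ)) :
    HasMean (fun t => φ (torusFlow μ t)) (∫ x : UnitAddTorus ι, φ x) := by
  have hc := continuous_torusFlow μ
  have hi : ∀ ψ : C(UnitAddTorus ι, ℂ), Integrable ψ := fun ψ =>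
    ψ.continuous.integrable_of_hasCompactSupport (HasCompactSupport.of_compactSpace ψ)
  have hspan : ∀ ψ ∈ Submodule.span ℂ (range (mFourier (d := ι))),
      HasMean (fun t => ψ (torusFlow μ t)) (∫ x : UnitAddTorus ι, ψ x) := by
    intro ψ hψ
    induction hψ using Submodule.span_induction with
    | mem x hx =>
      obtain ⟨n, rfl⟩ := hx
      simp only [mFourier_torusFlow]
      by_cases hn : n = 0
      · subst hn
        simp only [mFourier_zero, Pi.zero_apply, Int.cast_zero, zero_mul, Finset.sum_const_zero,
          ContinuousMap.one_apply, integral_const, volume_real_univ_unitAddTorus, one_smul]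
        exact hasMean_expi_zero
      · rw [integral_mFourier_of_ne_zero hn]
        exact hasMean_expi_of_ne_zero fun h => hn (hμ n h)
    | zero => simpa using hasMean_zero
    | add x y _ _ hx hy =>
      have := HasMean.add (by fun_prop) (by fun_prop) hx hy
      rw [← integral_add (hi x) (hi y)] at this
      exact this
    | smul c x _ hx =>
      have := hx.const_mul c
      rw [← integral_const_mul] at this
      exact this
  refine HasMean.of_approx (by fun_prop) fun ε hε => ?_
  have hφ : φ ∈ closure (Submodule.span ℂ (range (mFourier (d := ι))) :
      Set C(UnitAddTorus ι, ℂ)) := by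
    rw [← Submodule.topologicalClosure_coe, span_mFourier_closure_eq_top]
    trivial
  obtain ⟨ψ, hψ, hd⟩ := Metric.mem_closure_iff.1 hφ ε hε
  have hle : ∀ x, ‖φ x - ψ x‖ ≤ ε := fun x => by
    rw [← dist_eq_norm]
    exact (ContinuousMap.dist_apply_le_dist x).trans hd.le
  refine ⟨fun t => ψ (torusFlow μ t), ∫ x : UnitAddTorus ι, ψ x, by fun_prop, hspan ψ hψ,
    fun t => hle _, ?_⟩
  rw [← integral_sub (hi φ) (hi ψ)]
  simpa [volume_real_univ_unitAddTorus] using norm_integral_le_of_norm_le_const (μ := (volume : Measure (UnitAddTorus ι)))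
    (Eventually.of_forall hle)

/-- **Kronecker's theorem** on simultaneous inhomogeneous approximation. -/
theorem exists_norm_expi_sub_lt {μ : ι → ℝ}
    (hμ : ∀ n : ι → ℤ, ∑ i, (n i : ℝ) * μ i = 0 → n = 0) (θ : ι → ℝ) {ε : ℝ} (hε : 0 < ε) :
    ∃ t : ℝ, ∀ i, ‖expi (μ i) t - Complex.exp (θ i * Complex.I)‖ < ε := by
  -- A bump at the target point with positive integral. If the flow never came close to the target,
  -- the bump would vanish along it and have mean zero, against equidistribution.
  set φ : UnitAddTorus ι → ℝ := fun x =>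
    max 0 (ε - ∑ i, ‖(fourier 1 (x i) : ℂ) - Complex.exp (θ i * Complex.I)‖) with hφ
  have hφc : Continuous φ := by fun_prop
  have hpos : 0 < ∫ x, φ x := by
    refine hφc.integral_pos_of_hasCompactSupport_nonneg_nonzero
      (HasCompactSupport.of_compactSpace φ) (fun x => le_max_left _ _)
      (x := fun i => ((θ i / (2 * Real.pi) : ℝ) : AddCircle (1 : ℝ))) ?_
    simp only [hφ, fourier_coe_div]
    simp [hε.ne', hε.le]
  by_contra! hcon
  have hz : ∀ t, φ (torusFlow μ t) = 0 := by
    intro t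
    obtain ⟨i, hi⟩ := hcon t
    refine max_eq_left (sub_nonpos.2 (hi.trans ?_))
    have : ∀ j, (fourier 1 (torusFlow μ t j) : ℂ) = expi (μ j) t := fun j => by
      rw [torusFlow, fourier_coe_div, expi_apply]
      push_cast
      ring_nf
    simp only [this]
    exact Finset.single_le_sum (f := fun j => ‖expi (μ j) t - Complex.exp (θ j * Complex.I)‖)
      (fun j _ => norm_nonneg _) (Finset.mem_univ i)
  have h := hasMean_torusFlow hμ ⟨fun x => (φ x : ℂ), by fun_prop⟩
  simp only [ContinuousMap.coe_mk, hz, Complex.ofReal_zero] at h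
  have := h.unique hasMean_zero
  rw [integral_complex_ofReal] at this
  exact hpos.ne' (by exact_mod_cast this)

end Torus

/-! ### Riesz products and Bohr's inequality -/

theorem expi_add_left (μ ν t : ℝ) : expi (μ + ν) t = expi μ t * expi ν t := by
  simp only [expi_apply]
  rw [← Complex.exp_add]
  congr 1
  push_cast
  ring

theorem expi_sum {ι : Type*} (s : Finset ι) (μ : ι → ℝ) (t : ℝ) :
    expi (∑ i ∈ s, μ i) t = ∏ i ∈ s, expi (μ i) t := by
  simp only [expi_apply]
  rw [← Complex.exp_sum]
  congr 1
  push_cast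
  rw [Finset.sum_mul, Finset.sum_mul]

theorem hasMean_expi (μ : ℝ) : HasMean (expi μ) (if μ = 0 then 1 else 0) := by
  split_ifs with h
  · rw [h]; exact hasMean_expi_zero
  · exact hasMean_expi_of_ne_zero h

theorem star_expi (μ t : ℝ) : (starRingEnd ℂ) (expi μ t) = expi (-μ) t := by
  simp only [expi_apply]
  rw [← Complex.exp_conj]
  simp

/-- Coefficients of the factor `1 + Re (ω e^{-iμt})` of a Riesz product. -/
def rieszCoeff (ω : ℂ) (s : ℤ) : ℂ := if s = 0 then 1 else if s = 1 then ω / 2 else star ω / 2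

theorem one_add_re_eq_sum (ω : ℂ) (μ t : ℝ) : ((1 + (ω * expi (-μ) t).re : ℝ) : ℂ)
    = ∑ s ∈ ({0, 1, -1} : Finset ℤ), rieszCoeff ω s * expi (-(s * μ)) t := by
  rw [Finset.sum_insert (by decide), Finset.sum_insert (by decide), Finset.sum_singleton]
  simp only [rieszCoeff]
  have h : (((ω * expi (-μ) t).re : ℝ) : ℂ) = (ω * expi (-μ) t + star ω * expi μ t) / 2 := by
    rw [Complex.re_eq_add_conj, map_mul, star_expi, neg_neg]
    rfl
  push_cast
  rw [h]
  simp
  ring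

/-- An inequality of Bohr for functions whose frequencies are independent, proved with a Riesz
product. -/
theorem sum_norm_le_of_independent {ι : Type*} [Fintype ι] [DecidableEq ι] (F : ℝ →ᵇ ℂ) {b : ℝ → ℂ}
    (hb : ∀ μ, HasMean (fun t => F t * expi (-μ) t) (b μ)) {μ : ι → ℝ}
    (h0 : ∀ p : ι → ℤ, ∑ i, (p i : ℝ) * μ i = 0 → p = 0)
    (h1 : ∀ p : ι → ℤ, b (∑ i, (p i : ℝ) * μ i) ≠ 0 → ∃ i, p = Pi.single i 1) :
    ∑ i, ‖b (μ i)‖ ≤ 2 * ‖F‖ := by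
  choose ω hω1 hω using fun i => RCLike.exists_norm_eq_mul_self (b (μ i))
  -- Each factor is nonnegative because `ω i` is unimodular; `ω i` rotates `b (μ i)` to its modulus.
  set κ : ℝ → ℝ := fun t => ∏ i, (1 + (ω i * expi (-μ i) t).re) with hκ
  have hκc : Continuous κ := by fun_prop
  have hκ0 : ∀ t, 0 ≤ κ t := by
    intro t
    refine Finset.prod_nonneg fun i _ => ?_
    have h := (abs_le.1 (Complex.abs_re_le_norm (ω i * expi (-μ i) t))).1
    rw [norm_mul, hω1, norm_expi_apply] at h
    linarith
  set P : Finset (ι → ℤ) := Fintype.piFinset fun _ => ({0, 1, -1} : Finset ℤ) with hP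
  set C : (ι → ℤ) → ℂ := fun p => ∏ i, rieszCoeff (ω i) (p i) with hC
  have hexp : ∀ t, (κ t : ℂ) = ∑ p ∈ P, C p * expi (-∑ i, (p i : ℝ) * μ i) t := by
    intro t
    simp only [hκ]
    push_cast
    have : ∀ i, (1 + ((ω i * expi (-μ i) t).re : ℂ))
        = ∑ s ∈ ({0, 1, -1} : Finset ℤ), rieszCoeff (ω i) s * expi (-(s * μ i)) t := by
      intro i
      rw [← one_add_re_eq_sum]
      push_cast
      rfl
    simp only [this]
    rw [Finset.prod_univ_sum]
    refine Finset.sum_congr rfl fun p _ => ?_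
    rw [Finset.prod_mul_distrib, ← Finset.sum_neg_distrib, expi_sum]
  -- By independence only the term `p = 0` of the expanded product has frequency zero, so the mean
  -- is `1`.
  have hK : HasMean (fun t => (κ t : ℂ)) ((1 : ℝ) : ℂ) := by
    have h := HasMean.sum P (g := fun p t => C p * expi (-∑ i, (p i : ℝ) * μ i) t)
      (fun p _ => by fun_prop) fun p _ => (hasMean_expi _).const_mul (C p)
    simp only [hexp]
    convert! h using 1
    rw [Finset.sum_eq_single 0]
    · simp [hC, rieszCoeff]
    · intro p _ hp
      rw [if_neg fun h => hp (h0 p (neg_eq_zero.1 h)), mul_zero]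
    · intro h
      exact absurd (by simp [hP]) h
  -- By `h1` only unit vectors `p` meet a nonzero coefficient of `F`; such a `p` carries the factor
  -- `ω i / 2`, the source of the constant `2`.
  have hFK : HasMean (fun t => F t * κ t) (∑ i, (‖b (μ i)‖ : ℂ) / 2) := by
    have h := HasMean.sum P
      (g := fun p t => C p * (F t * expi (-∑ i, (p i : ℝ) * μ i) t))
      (fun p _ => by fun_prop) fun p _ => (hb _).const_mul (C p)
    convert! h using 1
    · ext t
      rw [hexp, Finset.mul_sum]
      exact Finset.sum_congr rfl fun p _ => by ring
    · have hinj : Function.Injective fun i : ι => (Pi.single i 1 : ι → ℤ) := by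
        intro i j hij
        by_contra hne
        have := congrFun hij i
        simp [Pi.single_eq_of_ne hne] at this
      rw [← Finset.sum_subset (s₁ := Finset.univ.image fun i : ι => (Pi.single i 1 : ι → ℤ))]
      · rw [Finset.sum_image fun i _ j _ h => hinj h]
        refine Finset.sum_congr rfl fun i _ => ?_
        have e1 : ∑ j, ((Pi.single i 1 : ι → ℤ) j : ℝ) * μ j = μ i := by
          rw [Finset.sum_eq_single i] <;> simp +contextual [Pi.single_eq_of_ne]
        have e2 : C (Pi.single i 1) = ω i / 2 := by
          simp only [hC]
          rw [Finset.prod_eq_single i]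
          · simp [rieszCoeff]
          · intro j _ hj
            simp [rieszCoeff, Pi.single_eq_of_ne hj]
          · simp
        have e3 := hω i
        rw [e1, e2]
        simp only [RCLike.ofReal_eq_complex_ofReal] at e3
        rw [e3]
        ring
      · intro p hp
        obtain ⟨i, -, rfl⟩ := Finset.mem_image.1 hp
        rw [hP, Fintype.mem_piFinset]
        intro j
        by_cases hj : j = i
        · subst hj; simp
        · simp [Pi.single_eq_of_ne hj]
      · intro p _ hp
        by_contra hne
        obtain ⟨i, rfl⟩ := h1 p (right_ne_zero_of_mul hne)
        exact hp (Finset.mem_image_of_mem _ (Finset.mem_univ i))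
  have h := hFK.norm_le_mul (C := ‖F‖) hK hκc (fun _ => rfl) fun t => by
    rw [norm_mul, Complex.norm_real, Real.norm_eq_abs, abs_of_nonneg (hκ0 t)]
    exact mul_le_mul_of_nonneg_right (F.norm_coe_le_norm t) (hκ0 t)
  have e : ∑ i, (‖b (μ i)‖ : ℂ) / 2 = (((∑ i, ‖b (μ i)‖) / 2 : ℝ) : ℂ) := by
    push_cast
    rw [Finset.sum_div]
  rw [e, Complex.norm_real, Real.norm_eq_abs,
    abs_of_nonneg (by positivity)] at h
  linarith

/-! ### Absolutely convergent exponential series -/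

theorem hasSum_smul_expi_apply {ι : Type*} (μ : ι → ℝ) {c : ι → ℂ} (hc : Summable fun i => ‖c i‖)
    (t : ℝ) : HasSum (fun i => c i * expi (μ i) t) ((∑' i, c i • expi (μ i)) t) := by
  have hs : Summable fun i => c i • expi (μ i) := Summable.of_norm_bounded hc fun i => by
    rw [norm_smul]
    exact mul_le_of_le_one_right (norm_nonneg _) (norm_expi _)
  have := (BoundedContinuousFunction.evalCLM ℂ t).hasSum hs.hasSum
  simpa using this

open Classical in
theorem hasMean_tsum_mul_expi {ι : Type*} (μ : ι → ℝ) {c : ι → ℂ} (hc : Summable fun i => ‖c i‖)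
    (ν : ℝ) : HasMean (fun t => (∑' i, c i • expi (μ i)) t * expi (-ν) t)
      (∑' i, if μ i = ν then c i else 0) := by
  have hc' : Summable fun i => if μ i = ν then c i else 0 :=
    Summable.of_norm_bounded hc fun i => by split_ifs <;> simp
  refine HasMean.of_approx (by fun_prop) fun ε hε => ?_
  obtain ⟨s, hs⟩ := ((tendsto_order.1 (tendsto_tsum_compl_atTop_zero fun i => ‖c i‖)).2 ε
    hε).exists
  refine ⟨fun t => ∑ i ∈ s, c i * expi (μ i - ν) t, ∑ i ∈ s, if μ i = ν then c i else 0,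
    by fun_prop, ?_, fun t => ?_, ?_⟩
  · refine HasMean.sum s (fun i _ => by fun_prop) fun i _ => ?_
    have := (hasMean_expi (μ i - ν)).const_mul (c i)
    simpa [sub_eq_zero] using this
  · have h := (hasSum_smul_expi_apply μ hc t).mul_right (expi (-ν) t)
    have e := h.summable.sum_add_tsum_compl (s := s)
    rw [h.tsum_eq] at e
    rw [← e]
    have : ∀ i, c i * expi (μ i) t * expi (-ν) t = c i * expi (μ i - ν) t := fun i => by
      rw [sub_eq_add_neg, expi_add_left, mul_assoc]
    simp only [this, add_sub_cancel_left]
    refine (tsum_of_norm_bounded (hc.subtype _).hasSum fun i => ?_).trans hs.le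
    rw [norm_mul, norm_expi_apply, mul_one]
    rfl
  · have e := hc'.sum_add_tsum_compl (s := s)
    rw [← e, add_sub_cancel_left]
    refine (tsum_of_norm_bounded (hc.subtype _).hasSum fun i => ?_).trans hs.le
    simp only [Function.comp]
    split_ifs <;> simp

end AlmostPeriodic

/-! ### Almost periodic functions in a strip and their coefficients -/

namespace APStrip

open AlmostPeriodic

/-- The real points of the strip. -/
def base (α β : EReal) : Set ℝ := {σ : ℝ | α < (σ : EReal) ∧ (σ : EReal) < β}

theorem isOpen_base (α β : EReal) : IsOpen (base α β) :=
  (isOpen_Ioi.preimage continuous_coe_real_ereal).inter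
    (isOpen_Iio.preimage continuous_coe_real_ereal)

instance ordConnected_base (α β : EReal) : OrdConnected (base α β) :=
  ⟨fun _ hx _ hy _ hz => ⟨hx.1.trans_le (EReal.coe_le_coe_iff.2 hz.1),
    (EReal.coe_le_coe_iff.2 hz.2).trans_lt hy.2⟩⟩

theorem strip_eq (α β : EReal) : strip α β = Complex.re ⁻¹' base α β := rfl

variable {α β : EReal} {f : ℂ → ℂ}

/-- An almost period moves any point of the reduced strip into a compact rectangle of height `l`,
changing the value by at most `1`. -/
theorem IsAlmostPeriodic.bounded (hf : IsAlmostPeriodic α β f) {a b : ℝ} (ha : a ∈ base α β)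
    (hb : b ∈ base α β) : ∃ M : ℝ, ∀ s : ℂ, a ≤ s.re → s.re ≤ b → ‖f s‖ ≤ M := by
  rcases lt_or_ge b a with hab | hab
  · exact ⟨0, fun s h1 h2 => absurd (h1.trans h2) (not_le.2 hab)⟩
  obtain ⟨l, hl, h⟩ := hf.translation a b ha.1 hab hb.2 1 one_pos
  have hK : IsCompact (Icc a b ×ℂ Icc 0 l) := isCompact_Icc.reProdIm isCompact_Icc
  have hKs : (Icc a b ×ℂ Icc 0 l) ⊆ strip α β := fun s hs =>
    (ordConnected_base α β).out ha hb hs.1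
  obtain ⟨M, hM⟩ := hK.exists_bound_of_continuousOn (hf.analytic.continuousOn.mono hKs)
  refine ⟨M + 1, fun s h1 h2 => ?_⟩
  obtain ⟨τ, ⟨hτ1, hτ2⟩, hτ⟩ := h (-s.im)
  have h3 := hM (s + Complex.I * τ) ⟨by simpa using ⟨h1, h2⟩, by
    simp only [mem_preimage, Complex.add_im, Complex.mul_im, Complex.I_re, Complex.ofReal_im,
      Complex.I_im, Complex.ofReal_re, zero_mul, one_mul, zero_add]
    exact ⟨by linarith, by linarith⟩⟩
  have h4 := hτ s h1 h2
  rw [norm_sub_rev] at h4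
  linarith [norm_sub_norm_le (f s) (f (s + Complex.I * τ))]

theorem IsAlmostPeriodic.exists_line (hf : IsAlmostPeriodic α β f) {σ : ℝ} (hσ : σ ∈ base α β) :
    ∃ F : ℝ →ᵇ ℂ, (∀ t, F t = f (σ + Complex.I * t)) ∧ IsAP F := by
  obtain ⟨M, hM⟩ := hf.bounded hσ hσ
  have hre : ∀ t : ℝ, (σ + Complex.I * t : ℂ).re = σ := fun t => by simp
  have hc : Continuous fun t : ℝ => f (σ + Complex.I * t) :=
    hf.analytic.continuousOn.comp_continuous (by fun_prop) fun t => by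
      rw [strip_eq, mem_preimage, hre]; exact hσ
  refine ⟨BoundedContinuousFunction.ofNormedAddCommGroup _ hc M fun t =>
    hM _ (hre t).ge (hre t).le, fun t => rfl, isAP_of_bohr _ fun ε hε => ?_⟩
  obtain ⟨l, hl, h⟩ := hf.translation σ σ hσ.1 le_rfl hσ.2 ε hε
  refine ⟨l, hl, fun t₀ => ?_⟩
  obtain ⟨τ, hτ, h⟩ := h t₀
  refine ⟨τ, hτ, fun t => ?_⟩
  have := h (σ + Complex.I * t) (hre t).ge (hre t).le
  simpa [mul_add, add_assoc] using this

theorem exp_line (μ σ t : ℝ) : Complex.exp (-(μ * (σ + Complex.I * t)))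
    = Complex.exp (-(μ * σ)) * expi (-μ) t := by
  rw [expi_apply, ← Complex.exp_add]
  congr 1
  push_cast
  ring

theorem IsAlmostPeriodic.exists_hasMean (hf : IsAlmostPeriodic α β f) (μ : ℝ) {σ : ℝ}
    (hσ : σ ∈ base α β) : ∃ m, HasMean (fun t => f (σ + Complex.I * t)
      * Complex.exp (-(μ * (σ + Complex.I * t)))) m := by
  obtain ⟨F, hF, hAP⟩ := hf.exists_line hσ
  obtain ⟨m, hm⟩ := (hAP.mul (isAP_expi (-μ))).exists_hasMean
  refine ⟨Complex.exp (-(μ * σ)) * m, ?_⟩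
  convert! hm.const_mul (Complex.exp (-(μ * σ))) using 2 with t
  rw [exp_line, BoundedContinuousFunction.mul_apply, hF]
  ring

/-- Cauchy's theorem on a rectangle: the vertical integrals differ by the two horizontal sides,
which are bounded independently of `T`. After division by `2T` this makes the coefficient
independent of the line. -/
theorem IsAlmostPeriodic.norm_integral_sub_le (hf : IsAlmostPeriodic α β f) (μ : ℝ) {σ₁ σ₂ : ℝ}
    (h1 : σ₁ ∈ base α β) (h2 : σ₂ ∈ base α β) (h12 : σ₁ ≤ σ₂) : ∃ M : ℝ, ∀ T : ℝ,
      ‖(∫ t in (-T)..T, f (σ₂ + Complex.I * t) * Complex.exp (-(μ * (σ₂ + Complex.I * t))))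
        - ∫ t in (-T)..T, f (σ₁ + Complex.I * t) * Complex.exp (-(μ * (σ₁ + Complex.I * t)))‖
        ≤ M := by
  obtain ⟨M, hM⟩ := hf.bounded h1 h2
  have hM0 : 0 ≤ M := (norm_nonneg _).trans (hM σ₁ (by simp) (by simpa using h12))
  set G : ℂ → ℂ := fun s => f s * Complex.exp (-(μ * s)) with hG
  set B := M * Real.exp (|μ| * max |σ₁| |σ₂|) with hB
  have hGb : ∀ s : ℂ, σ₁ ≤ s.re → s.re ≤ σ₂ → ‖G s‖ ≤ B := by
    intro s hs1 hs2
    rw [hG, norm_mul, Complex.norm_exp]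
    refine mul_le_mul (hM s hs1 hs2) (Real.exp_le_exp.2 ?_) (Real.exp_pos _).le hM0
    have : (-((μ : ℂ) * s)).re = -(μ * s.re) := by simp
    rw [this]
    refine (neg_le_abs _).trans ?_
    rw [abs_mul]
    exact mul_le_mul_of_nonneg_left (abs_le_max_abs_abs hs1 hs2) (abs_nonneg _)
  refine ⟨2 * (B * (σ₂ - σ₁)), fun T => ?_⟩
  have hd : DifferentiableOn ℂ G (uIcc σ₁ σ₂ ×ℂ uIcc (-T) T) := by
    refine DifferentiableOn.mul (hf.analytic.mono fun s hs => ?_) (by fun_prop)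
    exact (ordConnected_base α β).uIcc_subset h1 h2 hs.1
  have hrect := Complex.integral_boundary_rect_eq_zero_of_differentiableOn G
    (⟨σ₁, -T⟩ : ℂ) (⟨σ₂, T⟩ : ℂ) hd
  simp only at hrect
  have hhor : ∀ y : ℝ, ‖∫ x : ℝ in σ₁..σ₂, G (x + y * Complex.I)‖ ≤ B * (σ₂ - σ₁) := by
    intro y
    have := intervalIntegral.norm_integral_le_of_norm_le_const (a := σ₁) (b := σ₂)
      (f := fun x : ℝ => G (x + y * Complex.I)) (C := B) fun x hx => by
        rw [uIoc_of_le h12] at hx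
        exact hGb _ (by simpa using hx.1.le) (by simpa using hx.2)
    rwa [abs_of_nonneg (by linarith)] at this
  have hv := hhor T
  have hw := hhor (-T)
  simp only [hG] at hrect hv hw
  simp only [mul_comm Complex.I]
  set V₂ := ∫ t in (-T)..T, f (σ₂ + t * Complex.I) * Complex.exp (-(μ * (σ₂ + t * Complex.I)))
  set V₁ := ∫ t in (-T)..T, f (σ₁ + t * Complex.I) * Complex.exp (-(μ * (σ₁ + t * Complex.I)))
  have e : ‖Complex.I * (V₂ - V₁)‖ = ‖V₂ - V₁‖ := by rw [norm_mul, Complex.norm_I, one_mul]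
  rw [← e]
  simp only [smul_eq_mul] at hrect
  have e2 : Complex.I * (V₂ - V₁)
      = (∫ x : ℝ in σ₁..σ₂, f (x + T * Complex.I) * Complex.exp (-(μ * (x + T * Complex.I))))
      - ∫ x : ℝ in σ₁..σ₂, f (x + (-T : ℝ) * Complex.I)
          * Complex.exp (-(μ * (x + (-T : ℝ) * Complex.I))) := by
    linear_combination hrect
  rw [e2]
  exact (norm_sub_le _ _).trans (by linarith)

theorem IsAlmostPeriodic.mean_eq (hf : IsAlmostPeriodic α β f) (μ : ℝ) {σ₁ σ₂ : ℝ} {m₁ m₂ : ℂ}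
    (h1 : σ₁ ∈ base α β) (h2 : σ₂ ∈ base α β) (h12 : σ₁ ≤ σ₂)
    (hm1 : HasMean (fun t => f (σ₁ + Complex.I * t)
      * Complex.exp (-(μ * (σ₁ + Complex.I * t)))) m₁)
    (hm2 : HasMean (fun t => f (σ₂ + Complex.I * t)
      * Complex.exp (-(μ * (σ₂ + Complex.I * t)))) m₂) : m₁ = m₂ := by
  obtain ⟨M, hM⟩ := hf.norm_integral_sub_le μ h1 h2 h12
  have h := hm2.tendsto.sub hm1.tendsto
  have h0 : Tendsto (fun T : ℝ => (1 / (2 * T)) * M) atTop (𝓝 0) := by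
    have : Tendsto (fun T : ℝ => T⁻¹ * (M / 2)) atTop (𝓝 (0 * (M / 2))) :=
      tendsto_inv_atTop_zero.mul_const _
    rw [zero_mul] at this
    refine this.congr fun T => ?_
    rw [one_div, mul_inv]
    ring
  have hz := tendsto_nhds_unique h (squeeze_zero_norm' (by
    filter_upwards [eventually_gt_atTop 0] with T hT
    rw [← mul_sub, norm_mul]
    have hn : ‖(1 / (2 * T) : ℂ)‖ = 1 / (2 * T) := by
      rw [show (1 / (2 * T) : ℂ) = ((1 / (2 * T) : ℝ) : ℂ) by push_cast; ring,
        Complex.norm_real, Real.norm_eq_abs, abs_of_pos (by positivity)]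
    rw [hn]
    exact mul_le_mul_of_nonneg_left (hM T) (by positivity)) h0)
  exact (sub_eq_zero.1 hz).symm

theorem IsAlmostPeriodic.isFourierCoeff (hf : IsAlmostPeriodic α β f) (μ : ℝ) :
    IsFourierCoeff α β f μ (fourierCoeff α β f μ) := by
  have hex : ∃ c, IsFourierCoeff α β f μ c := by
    rcases (base α β).eq_empty_or_nonempty with he | ⟨σ₀, h₀⟩
    · exact ⟨0, fun σ h1 h2 => absurd (show σ ∈ base α β from ⟨h1, h2⟩) (by simp [he])⟩
    · obtain ⟨m, hm⟩ := hf.exists_hasMean μ h₀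
      refine ⟨m, fun σ h1 h2 => ?_⟩
      obtain ⟨m', hm'⟩ := hf.exists_hasMean μ (σ := σ) ⟨h1, h2⟩
      have : m = m' := by
        rcases le_total σ₀ σ with h | h
        · exact hf.mean_eq μ h₀ ⟨h1, h2⟩ h hm hm'
        · exact (hf.mean_eq μ ⟨h1, h2⟩ h₀ h hm' hm).symm
      rw [this]
      exact hm'.tendsto
  rw [fourierCoeff, dif_pos hex]
  exact hex.choose_spec

theorem IsAlmostPeriodic.hasMean_line (hf : IsAlmostPeriodic α β f) (μ : ℝ) {σ : ℝ}
    (hσ : σ ∈ base α β) : HasMean (fun t => f (σ + Complex.I * t) * expi (-μ) t)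
      (fourierCoeff α β f μ * Complex.exp (μ * σ)) := by
  obtain ⟨m, hm⟩ := hf.exists_hasMean μ hσ
  have h := tendsto_nhds_unique hm.tendsto (hf.isFourierCoeff μ σ hσ.1 hσ.2)
  rw [← h, mul_comm]
  convert! hm.const_mul (Complex.exp (μ * σ)) using 2 with t
  have : Complex.exp (μ * σ) * Complex.exp (-(μ * σ)) = 1 := by
    rw [← Complex.exp_add, add_neg_cancel, Complex.exp_zero]
  rw [exp_line]
  linear_combination (-(f (σ + Complex.I * t) * expi (-μ) t)) * this

/-! ### Absolute convergence of the Dirichlet series -/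

/-- The modulus of the term with exponent `k` on the vertical line with abscissa `σ`. -/
def termNorm (α β : EReal) (f : ℂ → ℂ) (k : fourierExponents α β f) (σ : ℝ) : ℝ :=
  ‖fourierCoeff α β f k‖ * Real.exp (k * σ)

theorem norm_coeff_mul_exp (μ σ : ℝ) :
    ‖fourierCoeff α β f μ * Complex.exp (μ * σ)‖ = ‖fourierCoeff α β f μ‖ * Real.exp (μ * σ) := by
  rw [norm_mul, Complex.norm_exp]
  simp

/-- An integer combination of exponents that is itself an exponent `e` has two representations in an
independent family, so its coefficients are those of `e` alone; if `e` were not in `J`, the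
coefficient `1` would have to be `0`. -/
theorem eq_single_of_sum_mem {E : Set ℝ} [DecidableEq E] (hind : LinearIndependent ℚ (fun x : E => (x : ℝ)))
    (J : Finset E) (p : J → ℤ) (h : ∑ i, (p i : ℝ) * ((i : E) : ℝ) ∈ E) :
    ∃ i, p = Pi.single i 1 := by
  set q : E →₀ ℚ := ∑ i : J, Finsupp.single (i : E) (p i : ℚ) with hq
  have hqv : ∀ i : J, q i = p i := by
    intro i
    rw [hq, Finsupp.finsetSum_apply, Finset.sum_eq_single i]
    · simp
    · intro j _ hj
      exact Finsupp.single_eq_of_ne fun h => hj (Subtype.ext h.symm)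
    · simp
  have hlin : Finsupp.linearCombination ℚ (fun x : E => (x : ℝ)) q
      = Finsupp.linearCombination ℚ (fun x : E => (x : ℝ)) (Finsupp.single ⟨_, h⟩ 1) := by
    rw [hq, map_sum]
    simp [Finsupp.linearCombination_single, Rat.smul_def]
  have hqe := hind hlin
  by_cases hJ : (⟨_, h⟩ : E) ∈ J
  · refine ⟨⟨_, hJ⟩, funext fun i => ?_⟩
    have h1 := hqv i
    rw [hqe] at h1
    by_cases hi : i = ⟨_, hJ⟩
    · rw [hi] at h1 ⊢
      rw [Finsupp.single_eq_same] at h1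
      rw [Pi.single_eq_same]
      exact_mod_cast h1.symm
    · rw [Finsupp.single_eq_of_ne fun h => hi (Subtype.ext h)] at h1
      rw [Pi.single_eq_of_ne hi]
      exact_mod_cast h1.symm
  · exfalso
    have h1 : q ⟨_, h⟩ = 1 := by rw [hqe, Finsupp.single_eq_same]
    have h2 : q ⟨_, h⟩ = 0 := by
      rw [hq, Finsupp.finsetSum_apply]
      refine Finset.sum_eq_zero fun i _ => Finsupp.single_eq_of_ne fun h' => hJ ?_
      rw [h']
      exact i.2
    rw [h1] at h2
    exact one_ne_zero h2

theorem eq_zero_of_sum_eq_zero {E : Set ℝ} (hind : LinearIndependent ℚ (fun x : E => (x : ℝ)))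
    (J : Finset E) (p : J → ℤ) (h : ∑ i, (p i : ℝ) * ((i : E) : ℝ) = 0) : p = 0 := by
  have hJ : LinearIndependent ℚ (fun i : J => ((i : E) : ℝ)) :=
    hind.comp _ Subtype.val_injective
  have := Fintype.linearIndependent_iff.1 hJ (fun i => (p i : ℚ)) (by
    simpa [Rat.smul_def] using h)
  exact funext fun i => by exact_mod_cast this i

/-- Bohr's inequality bounds all finite partial sums by twice the supremum norm of `f` on the line.
-/
theorem IsAlmostPeriodic.summable_termNorm (hf : IsAlmostPeriodic α β f)
    (hind : LinearIndependent ℚ (fun x : fourierExponents α β f => (x : ℝ))) {σ : ℝ}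
    (hσ : σ ∈ base α β) : Summable fun k => termNorm α β f k σ := by
  classical
  obtain ⟨F, hF, -⟩ := hf.exists_line hσ
  refine summable_of_sum_le (c := 2 * ‖F‖) (fun k => by unfold termNorm; positivity) fun J => ?_
  have h := sum_norm_le_of_independent F
    (b := fun μ => fourierCoeff α β f μ * Complex.exp (μ * σ))
    (fun μ => by simpa only [hF] using hf.hasMean_line μ hσ)
    (μ := fun i : J => ((i : fourierExponents α β f) : ℝ)) (eq_zero_of_sum_eq_zero hind J)
    fun p hp => eq_single_of_sum_mem hind J p (left_ne_zero_of_mul hp)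
  simp only [norm_coeff_mul_exp] at h
  rw [← Finset.sum_coe_sort J]
  exact h

/-- On each vertical line, `f` minus the sum of its absolutely convergent series is almost periodic
with all coefficients zero, so the uniqueness theorem applies. -/
theorem IsAlmostPeriodic.hasSum (hf : IsAlmostPeriodic α β f)
    (hind : LinearIndependent ℚ (fun x : fourierExponents α β f => (x : ℝ))) {s : ℂ}
    (hs : s ∈ strip α β) : HasSum (fun k : fourierExponents α β f =>
      fourierCoeff α β f k * Complex.exp (k * s)) (f s) := by
  classical
  have hσ : s.re ∈ base α β := hs
  obtain ⟨F, hF, hAP⟩ := hf.exists_line hσ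
  set c : fourierExponents α β f → ℂ := fun k =>
    fourierCoeff α β f k * Complex.exp ((k : ℝ) * s.re) with hc
  have hcs : Summable fun k => ‖c k‖ := by
    simp only [hc, norm_coeff_mul_exp]
    exact hf.summable_termNorm hind hσ
  set S : ℝ →ᵇ ℂ := ∑' k, c k • expi k with hS
  have hAPd := hAP.sub (isAP_tsum (fun k : fourierExponents α β f => (k : ℝ)) c hcs)
  have hzero : F - S = 0 := by
    refine hAPd.eq_zero_of_hasMean_zero fun μ => ?_
    have h1 := hf.hasMean_line μ hσ
    have h2 := (hasMean_tsum_mul_expi (fun k : fourierExponents α β f => (k : ℝ)) hcs μ).const_mul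
      (-1)
    simp only [← hF] at h1
    have h3 := HasMean.add (by fun_prop) (by fun_prop) h1 h2
    convert! h3 using 1
    · ext t
      simp only [BoundedContinuousFunction.coe_sub, Pi.sub_apply]
      ring
    · by_cases hμ : μ ∈ fourierExponents α β f
      · rw [tsum_eq_single ⟨μ, hμ⟩ fun k hk => if_neg fun h => hk (Subtype.ext h)]
        simp [hc]
      · have h0 : fourierCoeff α β f μ = 0 := not_not.1 hμ
        have : ∀ k : fourierExponents α β f, (if (k : ℝ) = μ then c k else 0) = 0 := fun k =>
          if_neg fun h : (k : ℝ) = μ => hμ (h ▸ k.2)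
        simp [this, h0]
  have h := hasSum_smul_expi_apply (fun k : fourierExponents α β f => (k : ℝ)) hcs s.im
  have e1 : (∑' k, c k • expi (k : ℝ)) s.im = f s := by
    have : S = F := (sub_eq_zero.1 hzero).symm
    rw [← hS, this, hF]
    congr 1
    apply Complex.ext <;> simp
  rw [e1] at h
  convert! h using 2 with k
  rw [hc, mul_assoc, expi_apply, ← Complex.exp_add]
  congr 2
  conv_lhs => rw [← Complex.re_add_im s]
  ring

/-! ### Closed polygons and Hurwitz's theorem -/

theorem exists_triangle {A B C : ℝ} (hA : 0 ≤ A) (hB : 0 ≤ B) (h1 : A ≤ B + C)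
    (h2 : B ≤ A + C) (h3 : C ≤ A + B) : ∃ φ ψ : ℝ,
      (A + B * Complex.exp (φ * Complex.I) + C * Complex.exp (ψ * Complex.I) : ℂ) = 0 := by
  have hc : ContinuousOn (fun φ : ℝ => ‖(A + B * Complex.exp (φ * Complex.I) : ℂ)‖)
      (Icc 0 Real.pi) := by fun_prop
  have h0 : ‖(A + B * Complex.exp ((0 : ℝ) * Complex.I) : ℂ)‖ = A + B := by
    rw [Complex.ofReal_zero, zero_mul, Complex.exp_zero, mul_one, ← Complex.ofReal_add,
      Complex.norm_real, Real.norm_eq_abs, abs_of_nonneg (by positivity)]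
  have hπ : ‖(A + B * Complex.exp (Real.pi * Complex.I) : ℂ)‖ ≤ C := by
    rw [Complex.exp_pi_mul_I, mul_neg_one, ← sub_eq_add_neg, ← Complex.ofReal_sub,
      Complex.norm_real, Real.norm_eq_abs, abs_le]
    constructor <;> linarith
  -- As `φ` runs from `0` to `π` the length of the sum of two sides passes from `A + B ≥ C` to `|A -
  -- B| ≤ C`; where it equals `C` the third side closes the triangle.
  obtain ⟨φ, -, hφ⟩ := intermediate_value_Icc' Real.pi_pos.le hc ⟨hπ, by rw [h0]; exact h3⟩
  refine ⟨φ, Complex.arg (-(A + B * Complex.exp (φ * Complex.I))), ?_⟩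
  have := Complex.norm_mul_exp_arg_mul_I (-(A + B * Complex.exp (φ * Complex.I)))
  rw [norm_neg] at this
  rw [← hφ, this]
  ring

/-- A summable family of lengths, none of which exceeds the sum of the others, can be arranged as
the sides of a closed polygon. -/
theorem exists_polygon {ι : Type*} {b : ι → ℝ} (hb : ∀ i, 0 ≤ b i) (hs : Summable b)
    (h : ∀ k, 2 * b k ≤ ∑' i, b i) :
    ∃ θ : ι → ℝ, HasSum (fun i => (b i : ℂ) * Complex.exp (θ i * Complex.I)) 0 := by
  classical
  set S := ∑' i, b i with hS
  have hS0 : 0 ≤ S := tsum_nonneg hb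
  rcases hS0.eq_or_lt with h0 | hpos
  · refine ⟨0, ?_⟩
    have : ∀ i, b i = 0 := fun i => le_antisymm (by linarith [h i]) (hb i)
    simp [this, hasSum_zero]
  have hne : {F : Finset ι | S / 2 < ∑ i ∈ F, b i}.Nonempty :=
    ((tendsto_order.1 hs.hasSum).1 (S / 2) (by linarith)).exists
  -- Take a minimal finite `F` carrying more than half of `S`, and `k` in `F`. The three groups
  -- `F.erase k`, `{k}` and the complement of `F` each have total length at most `S / 2`, so they
  -- form a triangle, each group being laid out in one direction.
  obtain ⟨F, hF, hmin⟩ := (wellFounded_lt (α := Finset ι)).has_min _ hne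
  simp only [mem_ofPred_eq] at hF hmin
  have hFn : F.Nonempty := by
    rw [Finset.nonempty_iff_ne_empty]
    rintro rfl
    simp only [Finset.sum_empty] at hF
    linarith
  obtain ⟨k, hk⟩ := hFn
  have hA : ∑ i ∈ F.erase k, b i ≤ S / 2 :=
    not_lt.1 fun hlt => hmin _ hlt (Finset.erase_ssubset hk)
  have hsum := Finset.add_sum_erase F b hk
  have hFS : ∑ i ∈ F, b i ≤ S := hs.sum_le_tsum F fun i _ => hb i
  obtain ⟨φ, ψ, hφψ⟩ := exists_triangle (A := ∑ i ∈ F.erase k, b i) (B := b k)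
    (C := S - ∑ i ∈ F, b i) (Finset.sum_nonneg fun i _ => hb i) (hb k)
    (by linarith) (by linarith [h k]) (by linarith [h k])
  refine ⟨fun i => if i ∈ F then (if i = k then φ else 0) else ψ, ?_⟩
  -- The series is summed with the common phase `ψ` everywhere and then corrected at the finitely
  -- many indices in `F`.
  have e1 : HasSum (fun i => (b i : ℂ) * Complex.exp (ψ * Complex.I))
      (S * Complex.exp (ψ * Complex.I)) := by
    refine HasSum.mul_right _ ?_
    exact_mod_cast hs.hasSum
  have e2 : HasSum (fun i => if i ∈ F then (b i : ℂ) *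
      (Complex.exp ((if i = k then φ else 0 : ℝ) * Complex.I) - Complex.exp (ψ * Complex.I)) else 0)
      (∑ i ∈ F, (b i : ℂ) * (Complex.exp ((if i = k then φ else 0 : ℝ) * Complex.I)
        - Complex.exp (ψ * Complex.I))) := by
    rw [Finset.sum_congr rfl fun i hi => (if_pos hi).symm]
    exact hasSum_sum_of_ne_finset_zero fun i hi => if_neg hi
  convert! e1.add e2 using 1
  · ext i
    by_cases hi : i ∈ F
    · simp only [if_pos hi]; ring
    · simp only [if_neg hi]; ring
  · rw [← Finset.add_sum_erase F _ hk]
    have : ∀ i ∈ F.erase k, (b i : ℂ) * (Complex.exp ((if i = k then φ else 0 : ℝ) * Complex.I)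
        - Complex.exp (ψ * Complex.I)) = b i * (1 - Complex.exp (ψ * Complex.I)) := by
      intro i hi
      rw [if_neg (Finset.ne_of_mem_erase hi)]
      simp
    rw [Finset.sum_congr rfl this, if_pos rfl, ← Finset.sum_mul]
    rw [← hsum] at hφψ
    push_cast at hφψ ⊢
    linear_combination -hφψ

/-- A form of Hurwitz's theorem: a small perturbation of a function with an isolated zero has a
zero nearby. -/
theorem exists_zero_of_norm_sub_lt {g h : ℂ → ℂ} {z₀ : ℂ} {r m : ℝ} (hr : 0 < r)
    (hg0 : g z₀ = 0) (hgm : ∀ z ∈ Metric.sphere z₀ r, m ≤ ‖g z‖)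
    (hh : DiffContOnCl ℂ h (Metric.ball z₀ r))
    (hgh : ∀ z ∈ Metric.closedBall z₀ r, ‖h z - g z‖ < m / 2) :
    ∃ z ∈ Metric.closedBall z₀ r, h z = 0 := by
  by_contra! hne
  have h0 := hgh z₀ (Metric.mem_closedBall_self hr.le)
  rw [hg0, sub_zero] at h0
  have hm : 0 < m / 2 := (norm_nonneg _).trans_lt h0
  have hcl : closure (Metric.ball z₀ r) = Metric.closedBall z₀ r := closure_ball z₀ hr.ne'
  -- Without zeros of `h`, the maximum principle holds for `1 / h`; but `|h| ≥ m / 2` on the circle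
  -- while `|h z₀| < m / 2`.
  have hinv : DiffContOnCl ℂ (fun z => (h z)⁻¹) (Metric.ball z₀ r) :=
    hh.inv fun z hz => hne z (hcl ▸ hz)
  have hle := Complex.norm_le_of_forall_mem_frontier_norm_le Metric.isBounded_ball hinv
    (C := (m / 2)⁻¹) (fun z hz => by
      rw [frontier_ball z₀ hr.ne'] at hz
      rw [norm_inv]
      refine inv_anti₀ hm ?_
      have h1 := hgh z (Metric.sphere_subset_closedBall hz)
      rw [norm_sub_rev] at h1
      linarith [norm_sub_norm_le (g z) (h z), hgm z hz])
    (subset_closure (Metric.mem_ball_self hr))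
  rw [norm_inv] at hle
  have hpos : 0 < ‖h z₀‖ := norm_pos_iff.2 (hne z₀ (Metric.mem_closedBall_self hr.le))
  linarith [(inv_le_inv₀ hpos hm).1 hle]

/-! ### Real parts of zeros and the polygon inequalities -/

theorem termNorm_pos (k : fourierExponents α β f) (σ : ℝ) : 0 < termNorm α β f k σ :=
  mul_pos (norm_pos_iff.2 k.2) (Real.exp_pos _)

theorem continuous_termNorm (k : fourierExponents α β f) : Continuous (termNorm α β f k) := by
  unfold termNorm
  fun_prop

theorem norm_term (k : fourierExponents α β f) (s : ℂ) :
    ‖fourierCoeff α β f k * Complex.exp (k * s)‖ = termNorm α β f k s.re := by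
  rw [norm_mul, Complex.norm_exp, termNorm]
  simp

/-- Supplies a summable majorant on a whole reduced strip from the two edges. -/
theorem termNorm_le_add (k : fourierExponents α β f) {a b x : ℝ} (hx : x ∈ Icc a b) :
    termNorm α β f k x ≤ termNorm α β f k a + termNorm α β f k b := by
  simp only [termNorm, ← mul_add]
  refine mul_le_mul_of_nonneg_left ?_ (norm_nonneg _)
  rcases le_total 0 (k : ℝ) with hk | hk
  · have := Real.exp_le_exp.2 (mul_le_mul_of_nonneg_left hx.2 hk)
    linarith [Real.exp_pos (k * a)]
  · have := Real.exp_le_exp.2 (mul_le_mul_of_nonpos_left hx.1 hk)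
    linarith [Real.exp_pos (k * b)]

theorem exists_Icc_subset_base {σ : ℝ} (hσ : σ ∈ base α β) {ε : ℝ} (hε : 0 < ε) :
    ∃ r, 0 < r ∧ r < ε ∧ Icc (σ - r) (σ + r) ⊆ base α β := by
  obtain ⟨r, hr, h⟩ := Metric.isOpen_iff.1 (isOpen_base α β) σ hσ
  refine ⟨min r ε / 2, by positivity, by linarith [min_le_right r ε], fun x hx => h ?_⟩
  rw [Metric.mem_ball, Real.dist_eq, abs_lt]
  constructor <;> linarith [hx.1, hx.2, min_le_left r ε, lt_min hr hε]

theorem IsAlmostPeriodic.two_mul_termNorm_le_of_zero (hf : IsAlmostPeriodic α β f)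
    (hind : LinearIndependent ℚ (fun x : fourierExponents α β f => (x : ℝ))) {s : ℂ}
    (hs : s ∈ strip α β) (h0 : f s = 0) (k : fourierExponents α β f) :
    2 * termNorm α β f k s.re ≤ ∑' i, termNorm α β f i s.re := by
  classical
  have h := hf.hasSum hind hs
  have hS := hf.summable_termNorm hind (σ := s.re) hs
  rw [h0] at h
  have h1 := h.summable.tsum_eq_add_tsum_ite k
  rw [h.tsum_eq] at h1
  have h2 := hS.tsum_eq_add_tsum_ite k
  have h3 : ‖∑' i, if i = k then 0 else fourierCoeff α β f i * Complex.exp (i * s)‖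
      ≤ ∑' i, if i = k then 0 else termNorm α β f i s.re := by
    refine tsum_of_norm_bounded (Summable.hasSum ?_) fun i => ?_
    · refine Summable.of_nonneg_of_le (fun i => ?_) (fun i => ?_) hS
      · split_ifs
        exacts [le_rfl, (termNorm_pos i _).le]
      · split_ifs
        exacts [(termNorm_pos i _).le, le_rfl]
    · split_ifs
      · simp
      · rw [norm_term]
  rw [eq_neg_of_add_eq_zero_right h1.symm, norm_neg, norm_term] at h3
  linarith

theorem IsAlmostPeriodic.continuousOn_tsum_termNorm (hf : IsAlmostPeriodic α β f)
    (hind : LinearIndependent ℚ (fun x : fourierExponents α β f => (x : ℝ))) :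
    ContinuousOn (fun σ => ∑' k, termNorm α β f k σ) (base α β) := by
  intro σ hσ
  obtain ⟨r, hr, -, hsub⟩ := exists_Icc_subset_base hσ one_pos
  have hc : ContinuousOn (fun σ => ∑' k, termNorm α β f k σ) (Icc (σ - r) (σ + r)) :=
    continuousOn_tsum (fun k => (continuous_termNorm k).continuousOn)
      ((hf.summable_termNorm hind (hsub ⟨le_rfl, by linarith⟩)).add
        (hf.summable_termNorm hind (hsub ⟨by linarith, le_rfl⟩)))
      fun k x hx => by
        rw [Real.norm_eq_abs, abs_of_pos (termNorm_pos k x)]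
        exact termNorm_le_add k hx
  exact (hc.continuousAt (Icc_mem_nhds (by linarith) (by linarith))).continuousWithinAt

/-- Translation by `t` multiplies the `k`-th term by `e^{i k t}`. Kronecker's theorem brings
finitely many of these factors near prescribed phases at once, and the remaining terms are uniformly
small. -/
theorem IsAlmostPeriodic.exists_translate_norm_sub_le (hf : IsAlmostPeriodic α β f)
    (hind : LinearIndependent ℚ (fun x : fourierExponents α β f => (x : ℝ))) {a b : ℝ}
    (ha : a ∈ base α β) (hb : b ∈ base α β) (θ : fourierExponents α β f → ℝ) {δ : ℝ}
    (hδ : 0 < δ) : ∃ t : ℝ, ∀ s : ℂ, s.re ∈ Icc a b → ‖f (s + Complex.I * t)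
      - ∑' k : fourierExponents α β f, fourierCoeff α β f k * Complex.exp (θ k * Complex.I)
        * Complex.exp (k * s)‖ ≤ δ := by
  classical
  set P : fourierExponents α β f → ℝ := fun k => termNorm α β f k a + termNorm α β f k b with hP
  have hP0 : ∀ k, 0 ≤ P k := fun k => (add_pos (termNorm_pos k a) (termNorm_pos k b)).le
  have hPs : Summable P := (hf.summable_termNorm hind ha).add (hf.summable_termNorm hind hb)
  -- The tail of `P` is below `δ / 4` and phases differ by at most `2`, so the terms outside `J`
  -- cost at most `δ / 2`; the accuracy asked of Kronecker's theorem below makes those in `J` cost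
  -- the other half.
  obtain ⟨J, hJ⟩ := ((tendsto_order.1 (tendsto_tsum_compl_atTop_zero P)).2 (δ / 4)
    (by positivity)).exists
  have hQ : 0 ≤ ∑ k ∈ J, P k := Finset.sum_nonneg fun k _ => hP0 k
  obtain ⟨t, ht⟩ := exists_norm_expi_sub_lt (μ := fun i : J => ((i : fourierExponents α β f) : ℝ))
    (fun p hp => eq_zero_of_sum_eq_zero hind J p hp) (fun i => θ i)
    (ε := δ / (2 * (∑ k ∈ J, P k + 1))) (by positivity)
  refine ⟨t, fun s hs => ?_⟩
  have hsb : s ∈ strip α β := (ordConnected_base α β).out ha hb hs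
  have hst : s + Complex.I * t ∈ strip α β := by
    rw [strip_eq, mem_preimage] at hsb ⊢
    simpa using hsb
  have hle : ∀ k, termNorm α β f k s.re ≤ P k := fun k => termNorm_le_add k hs
  have hn1 : ∀ k, ‖Complex.exp (θ k * Complex.I)‖ = 1 := fun k => Complex.norm_exp_ofReal_mul_I _
  have hgs : Summable fun k : fourierExponents α β f =>
      fourierCoeff α β f k * Complex.exp (θ k * Complex.I) * Complex.exp (k * s) := by
    refine Summable.of_norm_bounded hPs fun k => ?_
    rw [mul_right_comm, norm_mul, hn1, mul_one, norm_term]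
    exact hle k
  have hd := (hf.hasSum hind hst).sub hgs.hasSum
  set w : fourierExponents α β f → ℝ := fun k =>
    P k * ‖expi k t - Complex.exp (θ k * Complex.I)‖ with hw
  have hw2 : ∀ k, w k ≤ 2 * P k := by
    intro k
    have := norm_sub_le (expi k t) (Complex.exp (θ k * Complex.I))
    rw [norm_expi_apply, hn1] at this
    rw [mul_comm 2]
    exact mul_le_mul_of_nonneg_left (by linarith) (hP0 k)
  have hw0 : ∀ k, 0 ≤ w k := fun k => mul_nonneg (hP0 k) (norm_nonneg _)
  have hws : Summable w := Summable.of_nonneg_of_le hw0 hw2 (hPs.mul_left 2)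
  have hb1 : ‖f (s + Complex.I * t) - ∑' k : fourierExponents α β f,
      fourierCoeff α β f k * Complex.exp (θ k * Complex.I) * Complex.exp (k * s)‖
        ≤ ∑' k, w k := by
    rw [← hd.tsum_eq]
    refine tsum_of_norm_bounded hws.hasSum fun k => ?_
    have e : fourierCoeff α β f k * Complex.exp (k * (s + Complex.I * t))
        - fourierCoeff α β f k * Complex.exp (θ k * Complex.I) * Complex.exp (k * s)
        = fourierCoeff α β f k * Complex.exp (k * s)
          * (expi k t - Complex.exp (θ k * Complex.I)) := by
      have : Complex.exp (k * (s + Complex.I * t)) = Complex.exp (k * s) * expi k t := by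
        rw [expi_apply, ← Complex.exp_add]
        congr 1
        ring
      rw [this]
      ring
    rw [e, norm_mul, norm_term]
    exact mul_le_mul_of_nonneg_right (hle k) (norm_nonneg _)
  refine hb1.trans ?_
  rw [← hws.sum_add_tsum_compl (s := J)]
  have h1 : ∑ k ∈ J, w k ≤ δ / 2 := by
    calc ∑ k ∈ J, w k ≤ ∑ k ∈ J, P k * (δ / (2 * (∑ k ∈ J, P k + 1))) :=
          Finset.sum_le_sum fun k hk => mul_le_mul_of_nonneg_left (ht ⟨k, hk⟩).le (hP0 k)
      _ = (∑ k ∈ J, P k) * (δ / (2 * (∑ k ∈ J, P k + 1))) := by rw [Finset.sum_mul]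
      _ ≤ (∑ k ∈ J, P k + 1) * (δ / (2 * (∑ k ∈ J, P k + 1))) := by gcongr; linarith
      _ = δ / 2 := by field_simp
  have h2 : ∑' k : ((J : Set (fourierExponents α β f))ᶜ : Set _), w k ≤ δ / 2 := by
    have := Summable.tsum_le_tsum (fun k : ((J : Set (fourierExponents α β f))ᶜ : Set _) => hw2 k)
      (hws.subtype _) ((hPs.mul_left 2).subtype _)
    rw [tsum_mul_left] at this
    refine this.trans ?_
    have hJ' : ∑' k : ((J : Set (fourierExponents α β f))ᶜ : Set _), P k < δ / 4 := hJ
    linarith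
  linarith

/-- The polygon with sides `termNorm α β f k σ` yields a series `g` with rotated coefficients and `g
σ = 0`; translates of `f` approximate `g`, so Hurwitz's theorem moves the zero of `g` to one of `f`.
-/
theorem IsAlmostPeriodic.exists_zero_near (hf : IsAlmostPeriodic α β f)
    (hind : LinearIndependent ℚ (fun x : fourierExponents α β f => (x : ℝ)))
    (hne : (fourierExponents α β f).Nonempty) {σ : ℝ} (hσ : σ ∈ base α β)
    (h : ∀ k, 2 * termNorm α β f k σ ≤ ∑' i, termNorm α β f i σ) {ε : ℝ} (hε : 0 < ε) :
    ∃ s ∈ strip α β, f s = 0 ∧ |s.re - σ| < ε := by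
  classical
  obtain ⟨θ', hθ'⟩ := exists_polygon (fun i => (termNorm_pos i σ).le)
    (hf.summable_termNorm hind hσ) h
  set θ : fourierExponents α β f → ℝ := fun k => θ' k - (fourierCoeff α β f k).arg with hθ
  set c : fourierExponents α β f → ℂ := fun k =>
    fourierCoeff α β f k * Complex.exp (θ k * Complex.I) with hc
  have hcn : ∀ k, c k = ‖fourierCoeff α β f k‖ * Complex.exp (θ' k * Complex.I) := by
    intro k
    simp only [hc, hθ]
    nth_rw 1 [← Complex.norm_mul_exp_arg_mul_I (fourierCoeff α β f k)]
    rw [mul_assoc, ← Complex.exp_add]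
    congr 2
    push_cast
    ring
  have hcnorm : ∀ k (s : ℂ), ‖c k * Complex.exp (k * s)‖ = termNorm α β f k s.re := by
    intro k s
    rw [hc, mul_right_comm, norm_mul, Complex.norm_exp_ofReal_mul_I, mul_one, norm_term]
  set g : ℂ → ℂ := fun s => ∑' k : fourierExponents α β f, c k * Complex.exp (k * s) with hg
  have hgσ : g σ = 0 := by
    rw [hg]
    refine HasSum.tsum_eq ?_
    convert! hθ' using 2 with k
    rw [hcn, termNorm]
    push_cast
    ring
  obtain ⟨r, hr, hrε, hsub⟩ := exists_Icc_subset_base hσ hε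
  have ha : σ - r ∈ base α β := hsub ⟨le_rfl, by linarith⟩
  have hb : σ + r ∈ base α β := hsub ⟨by linarith, le_rfl⟩
  set V : Set ℂ := Complex.re ⁻¹' Ioo (σ - r) (σ + r) with hV
  have hVo : IsOpen V := isOpen_Ioo.preimage Complex.continuous_re
  have hVc : IsPreconnected V := ((convex_Ioo _ _).linear_preimage Complex.reLm).isPreconnected
  have hσV : (σ : ℂ) ∈ V := by simp [hV, hr]
  have hgd : DifferentiableOn ℂ g V :=
    Complex.differentiableOn_tsum_of_summable_norm
      ((hf.summable_termNorm hind ha).add (hf.summable_termNorm hind hb))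
      (fun k => by fun_prop) hVo fun k s hs => by
        rw [hcnorm]
        exact termNorm_le_add k (Ioo_subset_Icc_self hs)
  have hga := hgd.analyticOnNhd hVo
  -- If `g` vanished near `σ`, it would vanish on the whole vertical line, and so would its mean
  -- against each exponential; but that mean is a nonzero coefficient.
  have hgne : ¬ ∀ᶠ z in 𝓝 (σ : ℂ), g z = 0 := by
    intro hz
    have hz' := hga.eqOn_zero_of_preconnected_of_eventuallyEq_zero hVc hσV hz
    obtain ⟨ν, hν⟩ := hne
    set d : fourierExponents α β f → ℂ := fun k => c k * Complex.exp (k * σ) with hd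
    have hds : Summable fun k => ‖d k‖ := by
      simp only [hd, hcnorm]
      exact hf.summable_termNorm hind hσ
    have hm := hasMean_tsum_mul_expi (fun k : fourierExponents α β f => (k : ℝ)) hds ν
    have hzero : ∀ t : ℝ, (∑' k, d k • expi (k : ℝ)) t = 0 := by
      intro t
      have h1 := (hasSum_smul_expi_apply (fun k : fourierExponents α β f => (k : ℝ)) hds t).tsum_eq
      rw [← h1]
      have h2 : g (σ + Complex.I * t) = 0 := hz' (by simp [hV, hr])
      rw [← h2, hg]
      refine tsum_congr fun k => ?_
      rw [hd, mul_assoc, expi_apply, ← Complex.exp_add]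
      congr 2
      ring
    simp only [hzero, zero_mul] at hm
    have h3 := hm.unique hasMean_zero
    rw [tsum_eq_single ⟨ν, hν⟩ fun k hk => if_neg fun h => hk (Subtype.ext h), if_pos rfl] at h3
    have h4 := hcnorm ⟨ν, hν⟩ σ
    rw [show c ⟨ν, hν⟩ * Complex.exp (((⟨ν, hν⟩ : fourierExponents α β f) : ℝ) * σ) = 0 from h3,
      norm_zero] at h4
    exact (termNorm_pos _ _).ne h4
  have hiso := ((hga σ hσV).eventually_eq_zero_or_eventually_ne_zero).resolve_left hgne
  rw [eventually_nhdsWithin_iff, Metric.eventually_nhds_iff] at hiso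
  obtain ⟨R, hR, hiso⟩ := hiso
  set ρ := min R r / 2 with hρ
  have hρ0 : 0 < ρ := by positivity
  have hρR : ρ < R := by linarith [min_le_left R r, lt_min hR hr]
  have hρr : ρ < r := by linarith [min_le_right R r, lt_min hR hr]
  have hballV : Metric.closedBall (σ : ℂ) ρ ⊆ V := by
    intro z hz
    have h1 := (Complex.abs_re_le_norm (z - σ)).trans (by simpa [dist_eq_norm] using hz)
    rw [Complex.sub_re, Complex.ofReal_re, abs_le] at h1
    exact ⟨by linarith, by linarith⟩
  obtain ⟨z₁, hz₁, hmin⟩ := (isCompact_sphere (σ : ℂ) ρ).exists_isMinOn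
    (NormedSpace.sphere_nonempty.2 hρ0.le) (f := fun z => ‖g z‖)
    (hgd.continuousOn.mono (Metric.sphere_subset_closedBall.trans hballV)).norm
  have hm : 0 < ‖g z₁‖ := by
    refine norm_pos_iff.2 (hiso (by rw [Metric.mem_sphere.1 hz₁]; exact hρR) ?_)
    intro h
    rw [Metric.mem_sphere, show z₁ = (σ : ℂ) from h, dist_self] at hz₁
    exact hρ0.ne hz₁
  obtain ⟨t, ht⟩ := hf.exists_translate_norm_sub_le hind ha hb θ (δ := ‖g z₁‖ / 4) (by positivity)
  have hmaps : ∀ z ∈ V, z + Complex.I * t ∈ strip α β := by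
    intro z hz
    rw [strip_eq, mem_preimage]
    simpa using hsub (Ioo_subset_Icc_self hz)
  obtain ⟨z, hz, hfz⟩ := exists_zero_of_norm_sub_lt (g := g)
    (h := fun z => f (z + Complex.I * t)) (m := ‖g z₁‖) hρ0 hgσ (fun z hz => hmin hz)
    (by
      refine DifferentiableOn.diffContOnCl ?_
      rw [closure_ball _ hρ0.ne']
      exact hf.analytic.comp (by fun_prop) fun z hz => hmaps z (hballV hz))
    fun z hz => lt_of_le_of_lt (ht z (Ioo_subset_Icc_self (hballV hz))) (by linarith)
  refine ⟨z + Complex.I * t, hmaps z (hballV hz), hfz, ?_⟩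
  have h1 := hballV hz
  have h2 : (z + Complex.I * t).re = z.re := by simp
  rw [h2, abs_lt]
  exact ⟨by linarith [h1.1], by linarith [h1.2]⟩

/-- The description of `R_f` by the polygon inequalities. -/
theorem IsAlmostPeriodic.mem_realProj_iff (hf : IsAlmostPeriodic α β f)
    (hind : LinearIndependent ℚ (fun x : fourierExponents α β f => (x : ℝ)))
    (hne : (fourierExponents α β f).Nonempty) {σ : ℝ} :
    σ ∈ realProj α β f ↔ σ ∈ base α β ∧
      ∀ k, 2 * termNorm α β f k σ ≤ ∑' i, termNorm α β f i σ := by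
  constructor
  · rintro ⟨hcl, hσ⟩
    refine ⟨hσ, fun k => ?_⟩
    -- A strict failure of the inequality is an open condition, so it would persist at real parts of
    -- zeros near `σ`.
    by_contra! hlt
    have hcont := (hf.continuousOn_tsum_termNorm hind).continuousAt
      ((isOpen_base α β).mem_nhds hσ)
    have hev := hcont.eventually_lt ((continuous_termNorm k).const_mul 2).continuousAt hlt
    obtain ⟨_, hx, s, ⟨hs, h0⟩, rfl⟩ := mem_closure_iff_nhds.1 hcl _ hev
    exact absurd (hf.two_mul_termNorm_le_of_zero hind hs h0 k) (not_le.2 hx)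
  · rintro ⟨hσ, h⟩
    refine ⟨Metric.mem_closure_iff.2 fun ε hε => ?_, hσ⟩
    obtain ⟨s, hs, h0, hd⟩ := hf.exists_zero_near hind hne hσ h hε
    exact ⟨s.re, ⟨s, ⟨hs, h0⟩, rfl⟩, by rwa [dist_comm, Real.dist_eq]⟩

/-! ### Convexity of the defects -/

/-- The normalized defect of the `k`-th polygon inequality, a strictly convex function whose zeros
are the solutions of the `k`-th equation. -/
def defect (α β : EReal) (f : ℂ → ℂ) (k : fourierExponents α β f) (σ : ℝ) : ℝ :=
  Real.exp (-(k * σ)) * (∑' i, termNorm α β f i σ - 2 * termNorm α β f k σ)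

theorem defect_nonneg_iff (k : fourierExponents α β f) (σ : ℝ) :
    0 ≤ defect α β f k σ ↔ 2 * termNorm α β f k σ ≤ ∑' i, termNorm α β f i σ := by
  rw [defect, mul_nonneg_iff_of_pos_left (Real.exp_pos _), sub_nonneg]

theorem defect_pos_iff (k : fourierExponents α β f) (σ : ℝ) :
    0 < defect α β f k σ ↔ 2 * termNorm α β f k σ < ∑' i, termNorm α β f i σ := by
  rw [defect, mul_pos_iff_of_pos_left (Real.exp_pos _), sub_pos]

theorem defect_eq_zero_iff (k : fourierExponents α β f) (σ : ℝ) :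
    defect α β f k σ = 0 ↔ ∑' i, termNorm α β f i σ = 2 * termNorm α β f k σ := by
  rw [defect, mul_eq_zero, or_iff_right (Real.exp_ne_zero _), sub_eq_zero]

theorem IsAlmostPeriodic.mem_solutions_iff (hf : IsAlmostPeriodic α β f)
    (hind : LinearIndependent ℚ (fun x : fourierExponents α β f => (x : ℝ)))
    (k : fourierExponents α β f) {σ : ℝ} :
    σ ∈ solutions α β f k ↔ σ ∈ base α β ∧ defect α β f k σ = 0 := by
  classical
  rw [show σ ∈ solutions α β f k ↔ σ ∈ base α β ∧ HasSum
    (fun i : {i : fourierExponents α β f // i ≠ k} => termNorm α β f i σ) (termNorm α β f k σ)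
    from and_assoc.symm]
  refine and_congr_right fun hσ => ?_
  have hS := hf.summable_termNorm hind hσ
  have h1 := hS.tsum_eq_add_tsum_ite k
  have h2 : ∑' i : {i : fourierExponents α β f // i ≠ k}, termNorm α β f i σ
      = ∑' i, if i = k then 0 else termNorm α β f i σ := by
    have := tsum_subtype {i : fourierExponents α β f | i ≠ k} fun i => termNorm α β f i σ
    refine this.trans (tsum_congr fun i => ?_)
    by_cases hi : i = k <;> simp [hi]
  have hS' : Summable fun i : {i : fourierExponents α β f // i ≠ k} => termNorm α β f i σ :=
    hS.subtype {i | i ≠ k}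
  rw [hS'.hasSum_iff, h2, defect_eq_zero_iff]
  constructor <;> intro h <;> linarith

theorem IsAlmostPeriodic.continuousOn_defect (hf : IsAlmostPeriodic α β f)
    (hind : LinearIndependent ℚ (fun x : fourierExponents α β f => (x : ℝ)))
    (k : fourierExponents α β f) : ContinuousOn (defect α β f k) (base α β) := by
  have h1 := hf.continuousOn_tsum_termNorm hind
  have h2 := (continuous_termNorm k).continuousOn (s := base α β)
  unfold defect
  fun_prop

open Classical in
-- The normalization makes the only negative term, `i = k`, a constant; every other term is a
-- positive multiple of an exponential with nonzero rate.
theorem IsAlmostPeriodic.hasSum_defect (hf : IsAlmostPeriodic α β f)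
    (hind : LinearIndependent ℚ (fun x : fourierExponents α β f => (x : ℝ)))
    (k : fourierExponents α β f) {σ : ℝ} (hσ : σ ∈ base α β) :
    HasSum (fun i : fourierExponents α β f => (if i = k then -1 else 1) *
      (‖fourierCoeff α β f i‖ * Real.exp ((i - k) * σ))) (defect α β f k σ) := by
  have h1 := (hf.summable_termNorm hind hσ).hasSum.sub
    (hasSum_ite_eq k (2 * termNorm α β f k σ))
  have h2 := h1.mul_left (Real.exp (-(k * σ)))
  refine h2.congr_fun fun i => ?_
  have he : Real.exp ((i - k) * σ) = Real.exp (-(k * σ)) * Real.exp (i * σ) := by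
    rw [← Real.exp_add]
    ring_nf
  rw [he]
  by_cases hi : i = k
  · subst hi
    rw [if_pos rfl, if_pos rfl, termNorm]
    ring
  · rw [if_neg hi, if_neg hi, termNorm]
    ring

theorem exp_mul_lt_convex_combination {c x y z : ℝ} (hc : c ≠ 0) (hxy : x < y) (hyz : y < z) :
    Real.exp (c * y) < (z - y) / (z - x) * Real.exp (c * x)
      + (y - x) / (z - x) * Real.exp (c * z) := by
  have hzx : 0 < z - x := by linarith
  have h := strictConvexOn_exp.2 (mem_univ (c * x)) (mem_univ (c * z))
    (fun h => (hxy.trans hyz).ne (mul_left_cancel₀ hc h))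
    (show 0 < (z - y) / (z - x) from div_pos (by linarith) hzx)
    (show 0 < (y - x) / (z - x) from div_pos (by linarith) hzx) (by field_simp; ring)
  simp only [smul_eq_mul] at h
  convert! h using 2
  field_simp
  ring

/-- Strict convexity, obtained termwise; the second exponent `j` supplies the strict inequality. -/
theorem IsAlmostPeriodic.defect_neg_of_between (hf : IsAlmostPeriodic α β f)
    (hind : LinearIndependent ℚ (fun x : fourierExponents α β f => (x : ℝ)))
    {k j : fourierExponents α β f} (hjk : j ≠ k) {x y z : ℝ} (hx : x ∈ base α β)
    (hz : z ∈ base α β) (hxy : x < y) (hyz : y < z) (h1 : defect α β f k x ≤ 0)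
    (h2 : defect α β f k z ≤ 0) : defect α β f k y < 0 := by
  classical
  have hy : y ∈ base α β := (ordConnected_base α β).out hx hz ⟨hxy.le, hyz.le⟩
  have hzx : 0 < z - x := by linarith
  have ht1 : 0 < (z - y) / (z - x) := div_pos (by linarith) hzx
  have ht2 : 0 < (y - x) / (z - x) := div_pos (by linarith) hzx
  have hsum : (z - y) / (z - x) + (y - x) / (z - x) = 1 := by field_simp; ring
  have hs := ((hf.hasSum_defect hind k hx).mul_left ((z - y) / (z - x))).add
    ((hf.hasSum_defect hind k hz).mul_left ((y - x) / (z - x)))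
  have hstrict : ∀ i, i ≠ k → (if i = k then -1 else 1) *
      (‖fourierCoeff α β f i‖ * Real.exp ((i - k) * y))
      < (z - y) / (z - x) * ((if i = k then -1 else 1) *
        (‖fourierCoeff α β f i‖ * Real.exp ((i - k) * x)))
      + (y - x) / (z - x) * ((if i = k then -1 else 1) *
        (‖fourierCoeff α β f i‖ * Real.exp ((i - k) * z))) := by
    intro i hi
    have hik : (i : ℝ) - k ≠ 0 := sub_ne_zero.2 fun h => hi (Subtype.ext h)
    have := mul_lt_mul_of_pos_left (exp_mul_lt_convex_combination hik hxy hyz)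
      (norm_pos_iff.2 i.2)
    rw [if_neg hi]
    linarith
  have hlt := hasSum_lt (i := j) (fun i => ?_) (hstrict j hjk) (hf.hasSum_defect hind k hy) hs
  · have e1 := mul_nonpos_of_nonneg_of_nonpos ht1.le h1
    have e2 := mul_nonpos_of_nonneg_of_nonpos ht2.le h2
    linarith
  · by_cases hi : i = k
    · subst hi
      simp only [if_true, sub_self, zero_mul, Real.exp_zero]
      linear_combination ‖fourierCoeff α β f i‖ * hsum
    · exact (hstrict i hi).le

theorem exists_ne_ne (hcard : 2 < (fourierExponents α β f).encard)
    (k j : fourierExponents α β f) : ∃ i, i ≠ k ∧ i ≠ j := by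
  by_contra! h
  have hsub : fourierExponents α β f ⊆ {(k : ℝ), (j : ℝ)} := by
    intro x hx
    by_cases hk : (⟨x, hx⟩ : fourierExponents α β f) = k
    · left
      rw [← hk]
    · right
      rw [← h _ hk]
      rfl
  exact absurd ((encard_le_encard hsub).trans (by
    refine (encard_insert_le _ _).trans ?_
    rw [encard_singleton, one_add_one_eq_two])) (not_le.2 hcard)

/-- Two different terms, each at least half of the total, would exhaust it and leave nothing for a
third positive term. This is where three exponents are needed. -/
theorem IsAlmostPeriodic.eq_of_defect_nonpos (hf : IsAlmostPeriodic α β f)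
    (hind : LinearIndependent ℚ (fun x : fourierExponents α β f => (x : ℝ)))
    (hcard : 2 < (fourierExponents α β f).encard) {σ : ℝ} (hσ : σ ∈ base α β)
    {k j : fourierExponents α β f} (hk : defect α β f k σ ≤ 0) (hj : defect α β f j σ ≤ 0) :
    k = j := by
  classical
  by_contra hne
  obtain ⟨i, hik, hij⟩ := exists_ne_ne hcard k j
  rw [← not_lt, defect_pos_iff, not_lt] at hk hj
  have h := (hf.summable_termNorm hind hσ).sum_le_tsum {i, k, j}
    fun l _ => (termNorm_pos l σ).le
  rw [Finset.sum_insert (by simp [hik, hij]), Finset.sum_pair hne] at h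
  linarith [termNorm_pos i σ]

/-- One neighbourhood serves all `k`: near `σ` the total stays above half its value at `σ`, while
all but finitely many terms stay below a quarter of it; the remaining finitely many defects are
continuous. -/
theorem IsAlmostPeriodic.eventually_defect_pos (hf : IsAlmostPeriodic α β f)
    (hind : LinearIndependent ℚ (fun x : fourierExponents α β f => (x : ℝ)))
    (hne : (fourierExponents α β f).Nonempty) {σ : ℝ} (hσ : σ ∈ base α β) :
    ∀ᶠ x in 𝓝 σ, ∀ k, 0 < defect α β f k σ → 0 < defect α β f k x := by
  obtain ⟨r, hr, -, hsub⟩ := exists_Icc_subset_base hσ one_pos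
  have hPs := (hf.summable_termNorm hind (hsub ⟨le_rfl, by linarith⟩)).add
    (hf.summable_termNorm hind (hsub (show σ + r ∈ _ from ⟨by linarith, le_rfl⟩)))
  have hS : 0 < ∑' i, termNorm α β f i σ :=
    (hf.summable_termNorm hind hσ).tsum_pos (fun i => (termNorm_pos i σ).le) ⟨_, hne.some_mem⟩
      (termNorm_pos _ σ)
  have hSev := ((hf.continuousOn_tsum_termNorm hind).continuousAt
    ((isOpen_base α β).mem_nhds hσ)).eventually_const_lt (half_lt_self hS)
  have hfin := hPs.tendsto_cofinite_zero.eventually_lt_const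
    (u := (∑' i, termNorm α β f i σ) / 4) (by positivity)
  rw [Filter.eventually_cofinite] at hfin
  have hJ : ∀ᶠ x in 𝓝 σ, ∀ k ∈ {k : fourierExponents α β f | ¬ termNorm α β f k (σ - r)
      + termNorm α β f k (σ + r) < (∑' i, termNorm α β f i σ) / 4},
      0 < defect α β f k σ → 0 < defect α β f k x := by
    rw [Filter.eventually_all_finite hfin]
    intro k _
    by_cases hk : 0 < defect α β f k σ
    · filter_upwards [((hf.continuousOn_defect hind k).continuousAt
        ((isOpen_base α β).mem_nhds hσ)).eventually_const_lt hk] with x hx _ using hx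
    · exact Eventually.of_forall fun x h => absurd h hk
  filter_upwards [hJ, hSev, Icc_mem_nhds (show σ - r < σ by linarith)
    (show σ < σ + r by linarith)] with x hx1 hx2 hx3 k hk
  by_cases hkJ : termNorm α β f k (σ - r) + termNorm α β f k (σ + r)
      < (∑' i, termNorm α β f i σ) / 4
  · rw [defect_pos_iff]
    linarith [termNorm_le_add k hx3]
  · exact hx1 k hkJ hk

/-! ### Boundary points and gaps -/

theorem IsAlmostPeriodic.mem_realProj_iff_defect (hf : IsAlmostPeriodic α β f)
    (hind : LinearIndependent ℚ (fun x : fourierExponents α β f => (x : ℝ)))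
    (hcard : 2 < (fourierExponents α β f).encard) {σ : ℝ} :
    σ ∈ realProj α β f ↔ σ ∈ base α β ∧ ∀ k, 0 ≤ defect α β f k σ := by
  rw [hf.mem_realProj_iff hind (encard_pos.1 ((zero_lt_two' ℕ∞).trans hcard))]
  simp only [defect_nonneg_iff]

/-- Where one defect vanishes, no other can be negative. -/
theorem IsAlmostPeriodic.solutions_subset_realProj (hf : IsAlmostPeriodic α β f)
    (hind : LinearIndependent ℚ (fun x : fourierExponents α β f => (x : ℝ)))
    (hcard : 2 < (fourierExponents α β f).encard) (k : fourierExponents α β f) :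
    solutions α β f k ⊆ realProj α β f := by
  intro σ hσ
  obtain ⟨hσ, h0⟩ := (hf.mem_solutions_iff hind k).1 hσ
  refine (hf.mem_realProj_iff_defect hind hcard).2 ⟨hσ, fun j => ?_⟩
  by_contra! hj
  have := hf.eq_of_defect_nonpos hind hcard hσ h0.le hj.le
  subst this
  exact hj.ne h0

theorem mem_realProj_of_mem_frontier {σ : ℝ} (h : σ ∈ frontier (realProj α β f))
    (hσ : σ ∈ base α β) : σ ∈ realProj α β f :=
  ⟨closure_minimal inter_subset_left isClosed_closure h.1, hσ⟩

/-- If no defect vanishing at `σ` were negative anywhere, all defects would be nonnegative near `σ`,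
making it an interior point. The point `v` locates the side on which the second solution is sought.
-/
theorem IsAlmostPeriodic.exists_defect_eq_zero_of_frontier (hf : IsAlmostPeriodic α β f)
    (hind : LinearIndependent ℚ (fun x : fourierExponents α β f => (x : ℝ)))
    (hcard : 2 < (fourierExponents α β f).encard) {σ : ℝ}
    (h : σ ∈ frontier (realProj α β f)) (hσ : σ ∈ base α β) :
    ∃ k, defect α β f k σ = 0 ∧ ∃ v ∈ base α β, defect α β f k v < 0 := by
  have hR := ((hf.mem_realProj_iff_defect hind hcard).1 (mem_realProj_of_mem_frontier h hσ)).2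
  by_contra! hcon
  refine h.2 (mem_interior_iff_mem_nhds.2 ?_)
  filter_upwards [hf.eventually_defect_pos hind
    (encard_pos.1 ((zero_lt_two' ℕ∞).trans hcard)) hσ, (isOpen_base α β).mem_nhds hσ] with x hx hxb
  refine (hf.mem_realProj_iff_defect hind hcard).2 ⟨hxb, fun k => ?_⟩
  rcases (hR k).eq_or_lt with h0 | hpos
  · exact hcon k h0.symm x hxb
  · exact (hx k hpos).le

/-- Of three zeros the middle one would have negative defect. -/
theorem IsAlmostPeriodic.solutions_eq_pair (hf : IsAlmostPeriodic α β f)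
    (hind : LinearIndependent ℚ (fun x : fourierExponents α β f => (x : ℝ)))
    (hcard : 2 < (fourierExponents α β f).encard) {k : fourierExponents α β f} {c d : ℝ}
    (hcd : c < d) (hc : c ∈ solutions α β f k) (hd : d ∈ solutions α β f k) :
    solutions α β f k = {c, d} := by
  obtain ⟨j, hj, -⟩ := exists_ne_ne hcard k k
  refine Subset.antisymm (fun e he => ?_) (insert_subset hc (singleton_subset_iff.2 hd))
  rw [hf.mem_solutions_iff hind] at hc hd he
  rcases lt_trichotomy e c with h | h | h
  · exact absurd hc.2 (hf.defect_neg_of_between hind hj he.1 hd.1 h hcd he.2.le hd.2.le).ne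
  · exact Or.inl h
  rcases lt_trichotomy e d with h' | h' | h'
  · exact absurd he.2 (hf.defect_neg_of_between hind hj hc.1 hd.1 h h' hc.2.le hd.2.le).ne
  · exact Or.inr h'
  · exact absurd hd.2 (hf.defect_neg_of_between hind hj hc.1 he.1 hcd h' hc.2.le he.2.le).ne

theorem IsAlmostPeriodic.exists_solution_between (hf : IsAlmostPeriodic α β f)
    (hind : LinearIndependent ℚ (fun x : fourierExponents α β f => (x : ℝ)))
    (k : fourierExponents α β f) {x y : ℝ} (hx : x ∈ base α β) (hy : y ∈ base α β)
    (hxk : defect α β f k x ≤ 0) (hyk : 0 ≤ defect α β f k y) :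
    ∃ z ∈ uIcc x y, z ∈ solutions α β f k := by
  have hsub := (ordConnected_base α β).uIcc_subset hx hy
  obtain ⟨z, hz, h0⟩ := intermediate_value_uIcc ((hf.continuousOn_defect hind k).mono hsub)
    (mem_uIcc_of_le hxk hyk)
  exact ⟨z, hz, (hf.mem_solutions_iff hind k).2 ⟨hsub hz, h0⟩⟩

/-- Say the defect is negative at `v < σ`. As `σ` is not the least element, some `x < σ` lies in
`R_f`; by convexity `x` is not between `v` and `σ`, so the defect changes sign between `x` and `v`.
The other side is symmetric. -/
theorem IsAlmostPeriodic.encard_solutions (hf : IsAlmostPeriodic α β f)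
    (hind : LinearIndependent ℚ (fun x : fourierExponents α β f => (x : ℝ)))
    (hcard : 2 < (fourierExponents α β f).encard) {σ : ℝ}
    (h : σ ∈ frontier (realProj α β f)) (hσ : σ ∈ base α β)
    (hleast : ¬ IsLeast (realProj α β f) σ) (hgreatest : ¬ IsGreatest (realProj α β f) σ)
    {k : fourierExponents α β f} (hk : σ ∈ solutions α β f k) :
    (solutions α β f k).encard = 2 := by
  have hR := mem_realProj_of_mem_frontier h hσ
  obtain ⟨j, hj, -⟩ := exists_ne_ne hcard k k
  have hk0 := ((hf.mem_solutions_iff hind k).1 hk).2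
  obtain ⟨k', hk', v, hv, hvk⟩ := hf.exists_defect_eq_zero_of_frontier hind hcard h hσ
  obtain rfl : k' = k := hf.eq_of_defect_nonpos hind hcard hσ hk'.le hk0.le
  rcases lt_trichotomy v σ with hlt | heq | hgt
  · obtain ⟨x, hx, hxσ⟩ : ∃ x ∈ realProj α β f, x < σ := by
      by_contra! hcon
      exact hleast ⟨hR, hcon⟩
    obtain ⟨hxb, hxk⟩ := (hf.mem_realProj_iff_defect hind hcard).1 hx
    have hxv : x ≤ v := by
      by_contra! hvx
      exact absurd (hxk k')
        (not_le.2 (hf.defect_neg_of_between hind hj hv hσ hvx hxσ hvk.le hk'.le))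
    obtain ⟨z, hz, hzs⟩ := hf.exists_solution_between hind k' hv hxb hvk.le (hxk k')
    rw [uIcc_of_ge hxv] at hz
    have hzσ : z < σ := hz.2.trans_lt hlt
    rw [hf.solutions_eq_pair hind hcard hzσ hzs hk, encard_pair hzσ.ne]
  · exact absurd hk' (heq ▸ hvk).ne
  · obtain ⟨x, hx, hxσ⟩ : ∃ x ∈ realProj α β f, σ < x := by
      by_contra! hcon
      exact hgreatest ⟨hR, hcon⟩
    obtain ⟨hxb, hxk⟩ := (hf.mem_realProj_iff_defect hind hcard).1 hx
    have hvx : v ≤ x := by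
      by_contra! hxv
      exact absurd (hxk k')
        (not_le.2 (hf.defect_neg_of_between hind hj hσ hv hxσ hxv hk'.le hvk.le))
    obtain ⟨z, hz, hzs⟩ := hf.exists_solution_between hind k' hv hxb hvk.le (hxk k')
    rw [uIcc_of_le hvx] at hz
    have hσz : σ < z := hgt.trans_le hz.1
    rw [hf.solutions_eq_pair hind hcard hσz hk hzs, encard_pair hσz.ne]

/-- At the midpoint of a gap some defect is negative, and it is nonnegative at both ends. Its zeros
on either side lie in `R_f`, which the open gap avoids, so they are the endpoints. Conversely a
defect is negative between its two zeros. -/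
theorem IsAlmostPeriodic.isGap_iff (hf : IsAlmostPeriodic α β f)
    (hind : LinearIndependent ℚ (fun x : fourierExponents α β f => (x : ℝ)))
    (hcard : 2 < (fourierExponents α β f).encard) (c d : ℝ) :
    IsGap (realProj α β f) c d ↔ c < d ∧ ∃ k, solutions α β f k = {c, d} := by
  constructor
  · rintro ⟨hcd, hc, hd, hdisj⟩
    refine ⟨hcd, ?_⟩
    obtain ⟨hcb, hc0⟩ := (hf.mem_realProj_iff_defect hind hcard).1 hc
    obtain ⟨hdb, hd0⟩ := (hf.mem_realProj_iff_defect hind hcard).1 hd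
    have hnot : ∀ x ∈ Ioo c d, x ∉ realProj α β f := fun x hx hxR =>
      disjoint_left.1 hdisj hx hxR
    have hmI : (c + d) / 2 ∈ Ioo c d := ⟨by linarith, by linarith⟩
    have hmb : (c + d) / 2 ∈ base α β :=
      (ordConnected_base α β).out hcb hdb (Ioo_subset_Icc_self hmI)
    obtain ⟨k, hk⟩ : ∃ k, defect α β f k ((c + d) / 2) < 0 := by
      by_contra! hcon
      exact hnot _ hmI ((hf.mem_realProj_iff_defect hind hcard).2 ⟨hmb, hcon⟩)
    have hsub := hf.solutions_subset_realProj hind hcard k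
    refine ⟨k, hf.solutions_eq_pair hind hcard hcd ?_ ?_⟩
    · obtain ⟨z, hz, hzs⟩ := hf.exists_solution_between hind k hmb hcb hk.le (hc0 k)
      rw [uIcc_of_ge hmI.1.le] at hz
      rcases hz.1.eq_or_lt with h | h
      · rwa [h]
      · exact absurd (hsub hzs) (hnot z ⟨h, hz.2.trans_lt hmI.2⟩)
    · obtain ⟨z, hz, hzs⟩ := hf.exists_solution_between hind k hmb hdb hk.le (hd0 k)
      rw [uIcc_of_le hmI.2.le] at hz
      rcases hz.2.eq_or_lt with h | h
      · rwa [← h]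
      · exact absurd (hsub hzs) (hnot z ⟨hmI.1.trans_le hz.1, h⟩)
  · rintro ⟨hcd, k, hk⟩
    obtain ⟨j, hj, -⟩ := exists_ne_ne hcard k k
    have hc : c ∈ solutions α β f k := hk ▸ Or.inl rfl
    have hd : d ∈ solutions α β f k := hk ▸ Or.inr rfl
    have hsub := hf.solutions_subset_realProj hind hcard k
    refine ⟨hcd, hsub hc, hsub hd, disjoint_left.2 fun x hx hxR => ?_⟩
    rw [hf.mem_solutions_iff hind] at hc hd
    exact absurd (((hf.mem_realProj_iff_defect hind hcard).1 hxR).2 k)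
      (not_le.2 (hf.defect_neg_of_between hind hj hc.1 hd.1 hx.1 hx.2 hc.2.le hd.2.le))

end APStrip

end

/-! ### The three assertions -/

theorem mainTheorem8 (α β : EReal) (hαβ : α < β) (f : ℂ → ℂ)
    (hf : APStrip.IsAlmostPeriodic α β f)
    (hind : LinearIndependent ℚ (fun x : APStrip.fourierExponents α β f => (x : ℝ)))
    (hcard : 2 < (APStrip.fourierExponents α β f).encard) :
    -- each boundary point in `(α, β)` solves one and only one of the equations
    (∀ σ₀ ∈ frontier (APStrip.realProj α β f), α < (σ₀ : EReal) → (σ₀ : EReal) < β →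
      ∃! k : APStrip.fourierExponents α β f, σ₀ ∈ APStrip.solutions α β f k) ∧
    -- that equation has exactly two solutions unless the point is an extreme point of `R_f`
    (∀ σ₀ ∈ frontier (APStrip.realProj α β f), α < (σ₀ : EReal) → (σ₀ : EReal) < β →
      ¬ IsLeast (APStrip.realProj α β f) σ₀ → ¬ IsGreatest (APStrip.realProj α β f) σ₀ →
      ∀ k : APStrip.fourierExponents α β f, σ₀ ∈ APStrip.solutions α β f k →
        (APStrip.solutions α β f k).encard = 2) ∧
    -- the gaps are exactly the intervals between the two solutions of such an equation
    (∀ c d : ℝ, APStrip.IsGap (APStrip.realProj α β f) c d ↔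
      c < d ∧ ∃ k : APStrip.fourierExponents α β f, APStrip.solutions α β f k = {c, d}) := by
  refine ⟨fun σ₀ h h1 h2 => ?_, fun σ₀ h h1 h2 hl hg k hk =>
    hf.encard_solutions hind hcard h ⟨h1, h2⟩ hl hg hk, hf.isGap_iff hind hcard⟩
  obtain ⟨k, hk, -⟩ := hf.exists_defect_eq_zero_of_frontier hind hcard h ⟨h1, h2⟩
  refine ⟨k, (hf.mem_solutions_iff hind k).2 ⟨⟨h1, h2⟩, hk⟩, fun j hj => ?_⟩
  exact hf.eq_of_defect_nonpos hind hcard ⟨h1, h2⟩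
    ((hf.mem_solutions_iff hind j).1 hj).2.le hk.le
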